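/- Let $m\ge1$, $q=2^m$, and let $n\ge4$ be even; put $N=\binom{n}{n/2}$. Let $$R=R_q(n/2,n)=\bigl\{f\in\mathbb F_q[X_1,\dots,X_n]:\ \deg f\le n/2,\ \deg_{X_j}f\le q-1\ \text{for }1\le j\le n\bigr\}$$ be the $q$-ary Reed–Muller code of order $n/2$ in $n$ variables, where $\deg$ is the total degree and $\deg_{X_j}$ is the degree in $X_j$, and for $f\in R$ let $|f|=\#\{x\in\mathbb F_q^n: f(x)\ne0\}$ be its Hamming weight. Then $$\#\bigl\{f\in R:\ 2^{m+1}\ \text{divides}\ |f|\bigr\}=\Bigl(q^{N-1}+(q-1)\,q^{\frac N2-1}\Bigr)\,q^{\dim_{\mathbb F_q}R-N},$$ where $$\dim_{\mathbb F_q}R=\sum_{j=0}^{\lfloor n/(2q)\rfloor}(-1)^j\binom nj\binom{\frac{3n}2-qj}{n}.$$ -/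

import Mathlib

/-- The `q`-ary Reed–Muller code `R_q(d, n)`, `q = #F`: the `F`-space of polynomials in `n`
variables of total degree at most `d` and of degree at most `q - 1` in each variable. -/
noncomputable def ReedMuller (F : Type*) [Field F] [Fintype F] (d n : ℕ) :
    Submodule F (MvPolynomial (Fin n) F) :=
  MvPolynomial.restrictTotalDegree (Fin n) F d ⊓
    MvPolynomial.restrictDegree (Fin n) F (Fintype.card F - 1)

theorem mem_ReedMuller {F : Type*} [Field F] [Fintype F] {d n : ℕ}
    {f : MvPolynomial (Fin n) F} :
    f ∈ ReedMuller F d n ↔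
      f.totalDegree ≤ d ∧ ∀ j, f.degreeOf j ≤ Fintype.card F - 1 := by
  rw [ReedMuller, Submodule.mem_inf, MvPolynomial.mem_restrictTotalDegree,
    MvPolynomial.mem_restrictDegree]
  refine and_congr Iff.rfl ?_
  simp only [MvPolynomial.degreeOf_le_iff]
  exact ⟨fun h j s hs => h s hs j, fun h s hs j => h j s hs⟩

/-- The Hamming weight of the codeword `f`: the number of points of `F ^ n` at which `f` is
nonzero. -/
noncomputable def codewordWeight {F : Type*} [Field F] [Fintype F] [DecidableEq F] {n : ℕ}
    (f : MvPolynomial (Fin n) F) : ℕ :=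
  hammingNorm (fun x : Fin n → F => MvPolynomial.eval x f)

/-- The weight is `q ^ n` minus the number of zeros of `f` in `F ^ n`. -/
theorem codewordWeight_add_card_zeros {F : Type*} [Field F] [Fintype F] [DecidableEq F] {n : ℕ}
    (f : MvPolynomial (Fin n) F) :
    codewordWeight f + (Finset.univ.filter fun x : Fin n → F => MvPolynomial.eval x f = 0).card =
      Fintype.card F ^ n := by
  have h := Finset.card_filter_add_card_filter_not (s := (Finset.univ : Finset (Fin n → F)))
    (fun x => MvPolynomial.eval x f = 0)
  rw [Finset.card_univ, Fintype.card_fun, Fintype.card_fin] at h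
  rw [← h, add_comm]
  rfl

/-- The number of codewords of `R_q(d, n)` whose weight is divisible by `k`. -/
noncomputable def numCodewordsWeightDvd (F : Type*) [Field F] [Fintype F] [DecidableEq F]
    (d n k : ℕ) : ℕ :=
  Set.ncard {f : MvPolynomial (Fin n) F | f ∈ ReedMuller F d n ∧ k ∣ codewordWeight f}

set_option linter.unusedSectionVars false

/-! Write `f = ∑ aᵢ X^(Eᵢ)` and let `Q(a)` (`pairForm`) be the sum of `aᵢ aⱼ` over the unordered
pairs of monomials with product `X₁ ⋯ Xₙ`. The key fact (`IsTeichmullerLift.exists_card_zeros_eq`)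
is that the number of zeros of `f` is `q C` with `C ≡ Q(a)^(q-1)` modulo `2`. Since `2q` divides
`q^n`, it divides `|f|` exactly when `Q(a) = 0`. The degree bound `n/2` forces both monomials of a
pair to be squarefree of degree `n/2`, so `Q` is a hyperbolic form in `N` coefficients
(`exists_pairForm_eq_hyperbolic`), the others being free, and its zeros are easily counted.

The key fact refines Ax's theorem. Zeros are counted by the sums of `ψ(y f(x))`, where `ψ = (-1)^Tr`
takes values in the Witt vectors of `F`. By Stickelberger's congruence and Fourier inversion, `ψ` is
a polynomial in the Teichmüller lift `T` whose coefficient at the exponent with binary digit set `A`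
is `2^#A` times a principal unit (`exists_traceChar_eq_sum`). Expanding over the monomials, each
term becomes a product of power sums over `F`. A digit-sum estimate (`two_mul_le_sum_card_add`)
shows that every term is divisible by `2^(2m) = q^2`, and that the terms surviving modulo `2 q^2`
choose a complementary pair for each of the `m` binary digits. Their sum is `∏ₗ Q^(2^l) = Q^(q-1)`,
by Frobenius.

The dimension counts bounded exponent vectors by a generating function. -/

/-- The natural number whose binary digits equal to `1` are those at the positions in `A`. -/
def bitSum {m : ℕ} (A : Finset (Fin m)) : ℕ := ∑ l ∈ A, 2 ^ (l : ℕ)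

/-! ### Binary digits and multiples of `2 ^ m - 1`. -/

section BitSum

variable {m : ℕ}

theorem bitSum_univ : bitSum (Finset.univ : Finset (Fin m)) = 2 ^ m - 1 := by
  rw [bitSum, Fin.sum_univ_eq_sum_range (fun i => 2 ^ i), Nat.geomSum_eq le_rfl]
  simp

@[simp] theorem bitSum_empty : bitSum (∅ : Finset (Fin m)) = 0 := rfl

theorem bitSum_add_compl (A : Finset (Fin m)) : bitSum A + bitSum Aᶜ = 2 ^ m - 1 := by
  rw [← bitSum_univ]
  exact Finset.sum_add_sum_compl A _

theorem bitSum_le (A : Finset (Fin m)) : bitSum A ≤ 2 ^ m - 1 := by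
  have := bitSum_add_compl A
  omega

theorem bitSum_injective : Function.Injective (bitSum : Finset (Fin m) → ℕ) := by
  intro A B h
  have h' := Finset.geomSum_injective le_rfl
    (a₁ := A.map Fin.valEmbedding) (a₂ := B.map Fin.valEmbedding) (by simpa [bitSum] using h)
  exact Finset.map_injective _ h'

theorem bitSum_pos {A : Finset (Fin m)} (hA : A.Nonempty) : 0 < bitSum A :=
  Finset.sum_pos (fun _ _ => by positivity) hA

theorem bitSum_lt {A : Finset (Fin m)} (hA : A ≠ Finset.univ) : bitSum A < 2 ^ m - 1 := by
  have h := bitSum_add_compl A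
  have := bitSum_pos (A := Aᶜ) (Finset.nonempty_iff_ne_empty.2 (by simpa using hA))
  omega

theorem bitSum_insert {A : Finset (Fin m)} {l : Fin m} (hl : l ∉ A) :
    bitSum (insert l A) = 2 ^ (l : ℕ) + bitSum A :=
  Finset.sum_insert hl

theorem bitSum_singleton (l : Fin m) : bitSum {l} = 2 ^ (l : ℕ) := by
  simp [bitSum]

/-- Two sets of digits sum to a positive multiple of `2 ^ m - 1` if and only if they are
complementary, unless both are full. -/
theorem dvd_bitSum_add_bitSum_iff {A B : Finset (Fin m)} (hA : A ≠ Finset.univ)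
    (hB : B.Nonempty) : 2 ^ m - 1 ∣ bitSum A + bitSum B ↔ A = Bᶜ := by
  constructor
  · rintro ⟨k, hk⟩
    have h1 := bitSum_lt hA
    have h2 := bitSum_le B
    have h3 := bitSum_pos hB
    have hk1 : k = 1 := by
      have : k < 2 := by
        by_contra! h
        have := Nat.mul_le_mul_left (2 ^ m - 1) h
        omega
      have : k ≠ 0 := by
        rintro rfl
        omega
      omega
    have h4 := bitSum_add_compl B
    refine bitSum_injective ?_
    subst hk1
    omega
  · rintro rfl
    rw [add_comm, bitSum_add_compl]

/-- A sequence of digits, periodic of period `m`, whose `m`-digit number is a positive multiple of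
`2 ^ m - 1` has digit sum at least `m` over a period, and all its digits are `1` in case of
equality. -/
theorem le_sum_of_dvd_of_periodic (hm : 0 < m) (b : ℕ → ℕ) (hb : ∀ l, b (l + m) = b l)
    (hdvd : 2 ^ m - 1 ∣ ∑ l ∈ Finset.range m, 2 ^ l * b l)
    (hpos : 0 < ∑ l ∈ Finset.range m, 2 ^ l * b l) :
    m ≤ ∑ l ∈ Finset.range m, b l ∧
      (∑ l ∈ Finset.range m, b l = m → ∀ l < m, b l = 1) := by
  obtain ⟨r, rfl⟩ : ∃ r, m = r + 1 := ⟨m - 1, by omega⟩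
  set m := r + 1 with hm'
  -- In this proof `q` is `2 ^ m - 1`, not the order of the field.
  set q := 2 ^ m - 1 with hq
  have hq1 : 2 ^ m = q + 1 := by
    have : 0 < 2 ^ m := by positivity
    omega
  have hq0 : 0 < q := by
    have : 2 ^ 1 ≤ 2 ^ m := Nat.pow_le_pow_right (by norm_num) hm
    omega
  -- `A t` is the number with digits rotated by `t`. Rotation is division by `2` modulo `2 ^ m - 1`,
  -- so every `A t` is again a positive multiple of it, hence at least `2 ^ m - 1`. Summing `hrec`
  -- over a period turns these bounds into one on the digit sum.
  set A : ℕ → ℕ := fun t => ∑ l ∈ Finset.range m, 2 ^ l * b (l + t) with hA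
  have hrec : ∀ t, 2 * A (t + 1) = A t + q * b t := by
    intro t
    have h1 : A t = 2 * (∑ l ∈ Finset.range r, 2 ^ l * b (l + (t + 1))) + b t := by
      simp only [hA, hm']
      rw [Finset.sum_range_succ', Finset.mul_sum]
      congr 1
      · refine Finset.sum_congr rfl fun l _ => ?_
        rw [show l + 1 + t = l + (t + 1) by ring]
        ring
      · simp
    have h2 : A (t + 1) = (∑ l ∈ Finset.range r, 2 ^ l * b (l + (t + 1))) + 2 ^ r * b t := by
      simp only [hA, hm']
      rw [Finset.sum_range_succ, show r + (t + 1) = t + m by omega, hb]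
    have h3 : 2 * 2 ^ r = q + 1 := by rw [← hq1, hm', pow_succ, mul_comm]
    have h4 : 2 * 2 ^ r * b t = (q + 1) * b t := by rw [h3]
    rw [h1, h2]
    linarith
  have hcop : Nat.Coprime q 2 := by
    rw [Nat.coprime_two_right, Nat.odd_iff]
    have : 2 ^ m = 2 * 2 ^ r := by rw [hm', pow_succ, mul_comm]
    omega
  have hAt : ∀ t, q ∣ A t ∧ 0 < A t := by
    intro t
    induction t with
    | zero => simpa [hA] using ⟨hdvd, hpos⟩
    | succ t ih =>
      have h := hrec t
      refine ⟨hcop.dvd_of_dvd_mul_left ?_, by omega⟩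
      rw [h]
      exact dvd_add ih.1 (dvd_mul_right _ _)
  have hle : ∀ t, q ≤ A t := fun t => Nat.le_of_dvd (hAt t).2 (hAt t).1
  have hshift : ∑ t ∈ Finset.range m, A (t + 1) = ∑ t ∈ Finset.range m, A t := by
    have h1 := Finset.sum_range_succ A m
    rw [Finset.sum_range_succ'] at h1
    have : A m = A 0 := by
      simp only [hA]
      refine Finset.sum_congr rfl fun l _ => ?_
      rw [hb, add_zero]
    omega
  have hsum : ∑ t ∈ Finset.range m, A t = q * ∑ t ∈ Finset.range m, b t := by
    have h1 : ∑ t ∈ Finset.range m, 2 * A (t + 1) = ∑ t ∈ Finset.range m, (A t + q * b t) :=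
      Finset.sum_congr rfl fun t _ => hrec t
    rw [← Finset.mul_sum, hshift, Finset.sum_add_distrib, ← Finset.mul_sum] at h1
    omega
  constructor
  · have h1 : m * q ≤ ∑ t ∈ Finset.range m, A t := by
      simpa using Finset.card_nsmul_le_sum (Finset.range m) A q fun t _ => hle t
    rw [hsum, mul_comm] at h1
    exact Nat.le_of_mul_le_mul_left h1 hq0
  · intro h l hl
    have h1 : ∑ t ∈ Finset.range m, q = ∑ t ∈ Finset.range m, A t := by
      rw [hsum, h]
      simp [mul_comm]
    have h2 := (Finset.sum_eq_sum_iff_of_le fun t _ => hle t).1 h1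
    have h3 : q = A l := h2 l (Finset.mem_range.2 hl)
    have h4 : q = A (l + 1) := by
      rcases Nat.lt_or_ge (l + 1) m with h5 | h5
      · exact h2 _ (Finset.mem_range.2 h5)
      · have h6 : l + 1 = m := by omega
        have : A m = A 0 := by
          simp only [hA]
          refine Finset.sum_congr rfl fun l _ => ?_
          rw [hb, add_zero]
        rw [h6, this]
        exact h2 0 (Finset.mem_range.2 (by omega))
    have h5 := hrec l
    rw [← h3, ← h4] at h5
    have h6 : q * b l = q * 1 := by omega
    exact Nat.eq_of_mul_eq_mul_left hq0 h6

theorem le_sum_of_dvd_sum_two_pow_mul (hm : 0 < m) (b : Fin m → ℕ)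
    (hdvd : 2 ^ m - 1 ∣ ∑ l : Fin m, 2 ^ (l : ℕ) * b l)
    (hpos : 0 < ∑ l : Fin m, 2 ^ (l : ℕ) * b l) :
    m ≤ ∑ l, b l ∧ (∑ l, b l = m → ∀ l, b l = 1) := by
  set b' : ℕ → ℕ := fun l => b ⟨l % m, Nat.mod_lt _ hm⟩ with hb'
  have hbb : ∀ l : Fin m, b' l = b l := fun l => by
    simp only [hb', Nat.mod_eq_of_lt l.2]
  have h1 : ∑ l : Fin m, 2 ^ (l : ℕ) * b l = ∑ l ∈ Finset.range m, 2 ^ l * b' l := by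
    rw [← Fin.sum_univ_eq_sum_range (fun l => 2 ^ l * b' l)]
    exact Finset.sum_congr rfl fun l _ => by rw [hbb]
  have h2 : ∑ l : Fin m, b l = ∑ l ∈ Finset.range m, b' l := by
    rw [← Fin.sum_univ_eq_sum_range b']
    exact Finset.sum_congr rfl fun l _ => by rw [hbb]
  rw [h1] at hdvd hpos
  rw [h2]
  have := le_sum_of_dvd_of_periodic hm b' (fun l => by simp [hb']) hdvd hpos
  exact ⟨this.1, fun h l => by rw [← hbb]; exact this.2 h l l.2⟩

end BitSum

/-! ### Gauss sums over `F` with values in `W`, and the expansion of the additive character. -/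

/-- `T` is a multiplicative section of the reduction `π : W → F` onto the residue field `F` of
characteristic `2` of a local ring `W` with maximal ideal `(2)`. -/
structure IsTeichmullerLift {F W : Type*} [Field F] [CommRing W] (π : W →+* F) (T : F →*₀ W) :
    Prop where
  map_lift : ∀ u, π (T u) = u
  two_dvd : ∀ w, π w = 0 → 2 ∣ w
  isUnit : ∀ w, π w ≠ 0 → IsUnit w
  two_ne_zero : (2 : W) ≠ 0

section Teichmuller

variable {F W : Type*} [Field F] [Fintype F] [DecidableEq F] [CharP F 2] [CommRing W]
  [IsDomain W] {π : W →+* F} {T : F →*₀ W} {m : ℕ}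

theorem IsTeichmullerLift.pow_eq_one_iff (h : IsTeichmullerLift π T) (u : F) (k : ℕ) :
    T u ^ k = 1 ↔ u ^ k = 1 := by
  constructor
  · intro hu
    have := congrArg π hu
    simpa [h.map_lift] using this
  · intro hu
    rw [← map_pow, hu, map_one]

theorem map_pow_card_sub_one (T : F →*₀ W) {u : F} (hu : u ≠ 0) :
    T u ^ (Fintype.card F - 1) = 1 := by
  rw [← map_pow, FiniteField.pow_card_sub_one_eq_one u hu, map_one]

/-- Orthogonality of the powers of `T`. For `k = 0` the point `0` also counts, as `0 ^ 0 = 1`; hence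
a variable with exponent zero contributes a factor `q`, but one with a positive multiple of `q - 1`
only the unit `q - 1`. -/
theorem IsTeichmullerLift.sum_pow (h : IsTeichmullerLift π T) (k : ℕ) :
    ∑ x, T x ^ k = if k = 0 then (Fintype.card F : W)
      else if Fintype.card F - 1 ∣ k then (Fintype.card F : W) - 1 else 0 := by
  split_ifs with h0 h1
  · simp [h0]
  · obtain ⟨r, rfl⟩ := h1
    have : ∀ x : F, T x ^ ((Fintype.card F - 1) * r) = 1 - if x = 0 then 1 else 0 := by
      intro x
      split_ifs with hx
      · rw [hx, map_zero, zero_pow h0, sub_self]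
      · rw [pow_mul, map_pow_card_sub_one T hx, one_pow, sub_zero]
    simp [this, Finset.sum_sub_distrib]
  · have : ∃ u : Fˣ, u ^ k ≠ 1 := by
      by_contra! hu
      exact h1 ((FiniteField.forall_pow_eq_one_iff F k).1 hu)
    obtain ⟨u, hu⟩ := this
    have hu' : T u ^ k ≠ 1 := by
      rw [Ne, h.pow_eq_one_iff]
      intro hk
      exact hu (Units.ext (by simpa using hk))
    have h2 : ∑ x, T x ^ k = T u ^ k * ∑ x, T x ^ k := by
      conv_lhs => rw [← Equiv.sum_comp (Equiv.mulLeft₀ (u : F) u.ne_zero)]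
      rw [Finset.mul_sum]
      simp [mul_pow]
    have h3 : (1 - T u ^ k) * ∑ x, T x ^ k = 0 := by
      rw [sub_mul, one_mul, ← h2, sub_self]
    rcases mul_eq_zero.1 h3 with h4 | h4
    · exact absurd (sub_eq_zero.1 h4).symm hu'
    · exact h4

theorem IsTeichmullerLift.sum_pow_residue (h : IsTeichmullerLift π T) (k : ℕ) :
    ∑ x : F, x ^ k = if k ≠ 0 ∧ Fintype.card F - 1 ∣ k then 1 else 0 := by
  have h1 := congrArg π (h.sum_pow k)
  have h2 : (Fintype.card F : F) = 0 := FiniteField.cast_card_eq_zero F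
  have h3 : (-1 : F) = 1 := CharTwo.neg_eq 1
  rw [map_sum] at h1
  simp only [map_pow, h.map_lift] at h1
  rw [h1]
  by_cases h0 : k = 0
  · simp [h0, h2]
  · by_cases h4 : Fintype.card F - 1 ∣ k
    · simp [h0, h4, h2, h3]
    · simp [h0, h4]

/-- The absolute trace of an element of the field with `2 ^ m` elements. -/
def absTrace (m : ℕ) (u : F) : F := ∑ l : Fin m, u ^ 2 ^ (l : ℕ)

theorem absTrace_zero : absTrace m (0 : F) = 0 := by
  simp [absTrace]

theorem absTrace_add (u v : F) : absTrace m (u + v) = absTrace m u + absTrace m v := by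
  simp only [absTrace, add_pow_char_pow, Finset.sum_add_distrib]

theorem absTrace_eq_zero_or_one (hF : Fintype.card F = 2 ^ m) (u : F) :
    absTrace m u = 0 ∨ absTrace m u = 1 := by
  have h1 : absTrace m u ^ 2 = absTrace m u := by
    rw [absTrace, sum_pow_char, Fin.sum_univ_eq_sum_range (fun l => (u ^ 2 ^ l) ^ 2),
      Fin.sum_univ_eq_sum_range (fun l => u ^ 2 ^ l)]
    simp only [← pow_mul, ← pow_succ]
    have h2 := Finset.sum_range_succ (fun l => u ^ 2 ^ l) m
    rw [Finset.sum_range_succ', ← hF, FiniteField.pow_card] at h2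
    simpa using h2
  have h2 : absTrace m u * (absTrace m u - 1) = 0 := by
    rw [mul_sub, ← sq, h1, mul_one, sub_self]
  rcases mul_eq_zero.1 h2 with h3 | h3
  · exact Or.inl h3
  · exact Or.inr (sub_eq_zero.1 h3)

/-- The additive character `u ↦ (-1) ^ Tr u` with values in `W`. -/
def traceChar (hF : Fintype.card F = 2 ^ m) (T : F →*₀ W) : AddChar F W where
  toFun u := 1 - 2 * T (absTrace m u)
  map_zero_eq_one' := by simp [absTrace_zero]
  map_add_eq_mul' u v := by
    have h2 : (1 + 1 : F) = 0 := CharTwo.add_self_eq_zero 1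
    rw [absTrace_add]
    rcases absTrace_eq_zero_or_one hF u with hu | hu <;>
      rcases absTrace_eq_zero_or_one hF v with hv | hv <;>
      simp [hu, hv, h2]
    ring

theorem traceChar_apply (hF : Fintype.card F = 2 ^ m) (T : F →*₀ W) (u : F) :
    traceChar hF T u = 1 - 2 * T (absTrace m u) := rfl

/-- The absolute trace, as a polynomial, contains the monomial of exponent `2 ^ l` with coefficient
`1`. -/
theorem IsTeichmullerLift.sum_pow_bitSum_mul_absTrace (h : IsTeichmullerLift π T)
    (hF : Fintype.card F = 2 ^ m) (l : Fin m) :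
    ∑ u : F, u ^ bitSum ({l}ᶜ : Finset (Fin m)) * absTrace m u = 1 := by
  have h1 : ∀ l' : Fin m, ∑ u : F, u ^ (bitSum ({l}ᶜ : Finset (Fin m)) + 2 ^ (l' : ℕ)) =
      if l' = l then 1 else 0 := by
    intro l'
    have hl : ({l}ᶜ : Finset (Fin m)) ≠ Finset.univ := by simp
    rw [h.sum_pow_residue, ← bitSum_singleton l', hF]
    simp only [dvd_bitSum_add_bitSum_iff hl (Finset.singleton_nonempty l')]
    have h2 := bitSum_pos (Finset.singleton_nonempty l')
    refine if_congr ?_ rfl rfl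
    rw [compl_inj_iff, Finset.singleton_inj]
    constructor
    · exact fun h => h.2.symm
    · exact fun h => ⟨by omega, h.symm⟩
  simp only [absTrace, Finset.mul_sum, ← pow_add]
  rw [Finset.sum_comm]
  simp [h1]

theorem IsTeichmullerLift.sum_traceChar (h : IsTeichmullerLift π T)
    (hF : Fintype.card F = 2 ^ m) (hm : 0 < m) : ∑ u, traceChar hF T u = 0 := by
  refine AddChar.sum_eq_zero_of_ne_one ?_
  intro h1
  have h2 : ∀ u : F, absTrace m u = 0 := by
    intro u
    have h3 := DFunLike.congr_fun h1 u
    rw [traceChar_apply, AddChar.one_apply, sub_eq_self] at h3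
    have h4 := (mul_eq_zero.1 h3).resolve_left h.two_ne_zero
    rw [← h.map_lift (absTrace m u), h4, map_zero]
  have h3 := h.sum_pow_bitSum_mul_absTrace hF ⟨0, hm⟩
  -- The coefficient `1` of `u ^ 2 ^ 0` in the trace prevents it from vanishing identically.
  simp [h2] at h3

theorem IsTeichmullerLift.sum_traceChar_mul (h : IsTeichmullerLift π T)
    (hF : Fintype.card F = 2 ^ m) (hm : 0 < m) (u : F) :
    ∑ y, traceChar hF T (y * u) = if u = 0 then (2 : W) ^ m else 0 := by
  split_ifs with hu
  · simp [hu, hF]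
  · rw [← h.sum_traceChar hF hm]
    exact Equiv.sum_comp (Equiv.mulRight₀ u hu) (traceChar hF T)

/-- The Gauss sum of the power of the Teichmüller character with exponent `bitSum B`. -/
def bitGaussSum (hF : Fintype.card F = 2 ^ m) (T : F →*₀ W) (B : Finset (Fin m)) : W :=
  ∑ u, T u ^ bitSum B * traceChar hF T u

theorem IsTeichmullerLift.bitGaussSum_univ (h : IsTeichmullerLift π T)
    (hF : Fintype.card F = 2 ^ m) (hm : 0 < m) : bitGaussSum hF T Finset.univ = -1 := by
  have h1 : ∀ u : F, T u ^ bitSum (Finset.univ : Finset (Fin m)) * traceChar hF T u =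
      traceChar hF T u - if u = 0 then 1 else 0 := by
    intro u
    split_ifs with hu
    · have := bitSum_pos (A := (Finset.univ : Finset (Fin m))) ⟨⟨0, hm⟩, Finset.mem_univ _⟩
      rw [hu, map_zero, zero_pow this.ne', zero_mul, AddChar.map_zero_eq_one, sub_self]
    · rw [bitSum_univ, ← hF, map_pow_card_sub_one T hu, one_mul, sub_zero]
  rw [bitGaussSum]
  simp only [h1, Finset.sum_sub_distrib, h.sum_traceChar hF hm]
  simp

/-- As `ψ = 1 - 2 T(Tr)` and the power sum of `T` vanishes, a factor `2` comes out; modulo `2` the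
cofactor picks the coefficient of `u ^ 2 ^ l` in the trace. This is the case of one missing digit of
Stickelberger's congruence. -/
theorem IsTeichmullerLift.bitGaussSum_compl_singleton (h : IsTeichmullerLift π T)
    (hF : Fintype.card F = 2 ^ m) (l : Fin m) (hl : ({l}ᶜ : Finset (Fin m)).Nonempty) :
    ∃ g, bitGaussSum hF T {l}ᶜ = 2 * g ∧ π g = 1 := by
  have h0 : ∑ u : F, T u ^ bitSum ({l}ᶜ : Finset (Fin m)) = 0 := by
    have h1 := bitSum_pos hl
    have h2 : bitSum ({l}ᶜ : Finset (Fin m)) < 2 ^ m - 1 := bitSum_lt (by simp)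
    rw [h.sum_pow, if_neg h1.ne', if_neg]
    rw [hF]
    exact fun h3 => absurd (Nat.le_of_dvd h1 h3) (by omega)
  refine ⟨-∑ u : F, T u ^ bitSum ({l}ᶜ : Finset (Fin m)) * T (absTrace m u), ?_, ?_⟩
  · simp only [bitGaussSum, traceChar_apply, mul_sub, mul_one, Finset.sum_sub_distrib, h0,
      zero_sub, mul_neg, Finset.mul_sum]
    congr 1
    exact Finset.sum_congr rfl fun u _ => by ring
  · simp only [map_neg, map_sum, map_mul, map_pow, h.map_lift]
    rw [h.sum_pow_bitSum_mul_absTrace hF l, CharTwo.neg_eq]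

/-- The Jacobi sum attached to a set of digits `B` and the complement of a digit in `B`. -/
theorem IsTeichmullerLift.map_jacobiSum (h : IsTeichmullerLift π T)
    (hF : Fintype.card F = 2 ^ m) {l : Fin m} {B : Finset (Fin m)} (hl : l ∈ B) :
    π (∑ u, T u ^ bitSum B * T (1 - u) ^ bitSum ({l}ᶜ : Finset (Fin m))) = 1 := by
  -- By Frobenius, `1 + u` to an exponent with digit set `S` is the sum of all `u` to exponents with
  -- digit set inside `S`. In the power sums over `F` only `A = Bᶜ` survives.
  have h1 : ∀ u : F, (1 - u) ^ bitSum ({l}ᶜ : Finset (Fin m)) =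
      ∑ A ∈ ({l}ᶜ : Finset (Fin m)).powerset, u ^ bitSum A := by
    intro u
    rw [CharTwo.sub_eq_add, bitSum, ← Finset.prod_pow_eq_pow_sum]
    simp only [add_pow_char_pow, one_pow]
    rw [Finset.prod_one_add]
    simp only [bitSum, Finset.prod_pow_eq_pow_sum]
  simp only [map_sum, map_mul, map_pow, h.map_lift, h1, Finset.mul_sum, ← pow_add]
  rw [Finset.sum_comm]
  have h2 : ∀ A ∈ ({l}ᶜ : Finset (Fin m)).powerset,
      ∑ u : F, u ^ (bitSum B + bitSum A) = if A = Bᶜ then 1 else 0 := by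
    intro A hA
    have hA' : A ≠ Finset.univ := by
      rintro rfl
      simp at hA
    have hB := bitSum_pos ⟨l, hl⟩
    rw [h.sum_pow_residue, hF, add_comm (bitSum B)]
    simp only [dvd_bitSum_add_bitSum_iff hA' ⟨l, hl⟩]
    exact if_congr ⟨fun h => h.2, fun h => ⟨by omega, h⟩⟩ rfl rfl
  rw [Finset.sum_congr rfl h2, Finset.sum_ite_eq', if_pos]
  simpa using hl

/-- The Teichmüller lift as a multiplicative character. -/
def teichmullerChar (T : F →*₀ W) : MulChar F W where
  toMonoidHom := T
  map_nonunit' := by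
    intro a ha
    have : a = 0 := by simpa using ha
    simp [this]

theorem teichmullerChar_pow_apply {k : ℕ} (hk : k ≠ 0) (T : F →*₀ W) (u : F) :
    (teichmullerChar T ^ k) u = T u ^ k := by
  rw [MulChar.pow_apply' _ hk]
  rfl

/-- The classical relation between Gauss and Jacobi sums. Adding `q - 1 - 2 ^ l` to an exponent
removes its digit `l`, modulo `q - 1`. -/
theorem IsTeichmullerLift.bitGaussSum_mul_bitGaussSum (h : IsTeichmullerLift π T)
    (hF : Fintype.card F = 2 ^ m) {l : Fin m} {B : Finset (Fin m)} (hl : l ∉ B)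
    (hB : B.Nonempty) :
    bitGaussSum hF T B *
        (∑ u, T u ^ bitSum (insert l B) * T (1 - u) ^ bitSum ({l}ᶜ : Finset (Fin m))) =
      bitGaussSum hF T (insert l B) * bitGaussSum hF T {l}ᶜ := by
  have hl' : ({l}ᶜ : Finset (Fin m)).Nonempty := by
    obtain ⟨a, ha⟩ := hB
    refine ⟨a, ?_⟩
    rw [Finset.mem_compl, Finset.mem_singleton]
    rintro rfl
    exact hl ha
  have e1 : bitSum (insert l B) ≠ 0 := (bitSum_pos (Finset.insert_nonempty l B)).ne'
  have e2 : bitSum ({l}ᶜ : Finset (Fin m)) ≠ 0 := (bitSum_pos hl').ne'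
  have e3 : bitSum B ≠ 0 := (bitSum_pos hB).ne'
  have hadd : bitSum (insert l B) + bitSum ({l}ᶜ : Finset (Fin m)) =
      bitSum B + (Fintype.card F - 1) := by
    have := bitSum_add_compl ({l} : Finset (Fin m))
    rw [bitSum_singleton] at this
    rw [bitSum_insert hl, hF]
    omega
  have hmul : teichmullerChar T ^ bitSum (insert l B) *
      teichmullerChar T ^ bitSum ({l}ᶜ : Finset (Fin m)) = teichmullerChar T ^ bitSum B := by
    refine MulChar.ext fun u => ?_
    rw [← pow_add, teichmullerChar_pow_apply (by omega), teichmullerChar_pow_apply e3, hadd,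
      pow_add, map_pow_card_sub_one T u.ne_zero, mul_one]
  have hne : teichmullerChar T ^ bitSum B ≠ 1 := by
    intro h1
    have h2 : ∀ u : Fˣ, u ^ bitSum B = 1 := by
      intro u
      have h3 := DFunLike.congr_fun h1 (u : F)
      rw [teichmullerChar_pow_apply e3, MulChar.one_apply_coe, h.pow_eq_one_iff] at h3
      exact Units.ext (by simpa using h3)
    rw [FiniteField.forall_pow_eq_one_iff, hF] at h2
    have h4 : bitSum B < 2 ^ m - 1 := bitSum_lt fun h5 => hl (h5 ▸ Finset.mem_univ l)
    exact absurd (Nat.le_of_dvd (Nat.pos_of_ne_zero e3) h2) (by omega)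
  have key := jacobiSum_mul_nontrivial (hmul ▸ hne) (traceChar hF T)
  rw [hmul] at key
  simpa only [gaussSum, jacobiSum, teichmullerChar_pow_apply e1, teichmullerChar_pow_apply e2,
    teichmullerChar_pow_apply e3, bitGaussSum] using key

/-- Stickelberger's congruence in residue characteristic `2`. -/
theorem IsTeichmullerLift.exists_bitGaussSum_eq (h : IsTeichmullerLift π T)
    (hF : Fintype.card F = 2 ^ m) (hm : 0 < m) (A : Finset (Fin m)) (hA : A ≠ Finset.univ) :
    ∃ g, bitGaussSum hF T Aᶜ = 2 ^ A.card * g ∧ π g = 1 := by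
  induction A using Finset.induction_on with
  | empty =>
    refine ⟨-1, ?_, ?_⟩
    · rw [Finset.compl_empty, h.bitGaussSum_univ hF hm]
      simp
    · rw [map_neg, map_one, CharTwo.neg_eq]
  -- Enlarging `A` by `l` removes `l` from the digits of the Gauss sum; since the Jacobi sum is a
  -- principal unit, this costs exactly one factor `2`.
  | insert l A hl ih =>
    have hA' : A ≠ Finset.univ := fun h1 => hl (h1 ▸ Finset.mem_univ l)
    obtain ⟨g, hg, hg1⟩ := ih hA'
    have hB : (insert l A)ᶜ.Nonempty :=
      Finset.nonempty_iff_ne_empty.2 (by rwa [Ne, Finset.compl_eq_empty_iff])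
    have hlB : l ∉ (insert l A)ᶜ := by simp
    have hins : insert l (insert l A)ᶜ = Aᶜ := by
      ext a
      by_cases ha : a = l
      · simp [ha, hl]
      · simp [ha]
    have hne : ({l}ᶜ : Finset (Fin m)).Nonempty := by
      obtain ⟨a, ha⟩ := hB
      refine ⟨a, ?_⟩
      rw [Finset.mem_compl, Finset.mem_singleton]
      rintro rfl
      exact hlB ha
    obtain ⟨g', hg', hg1'⟩ := h.bitGaussSum_compl_singleton hF l hne
    have key := h.bitGaussSum_mul_bitGaussSum hF hlB hB
    have hJ := h.map_jacobiSum hF (Finset.mem_insert_self l (insert l A)ᶜ)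
    rw [hg', hins, hg] at key
    rw [hins] at hJ
    obtain ⟨J, hJu⟩ := h.isUnit _ (by rw [hJ]; exact one_ne_zero)
    rw [← hJu] at key hJ
    refine ⟨g * g' * (↑J⁻¹ : W), ?_, ?_⟩
    · rw [Finset.card_insert_of_notMem hl, pow_succ, ← mul_assoc, Units.eq_mul_inv_iff_mul_eq,
        key]
      ring
    · have h2 : π (↑J⁻¹ : W) = 1 := by
        have h3 := congrArg π (Units.mul_inv J)
        rwa [map_mul, hJ, one_mul, map_one] at h3
      rw [map_mul, map_mul, hg1, hg1', h2, one_mul, one_mul]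

/-- The exponents `bitSum A` with `A ≠ univ` run once through `0, …, q - 2`, so this is
orthogonality of the characters of `Fˣ`. The full sum is `∏ₗ (1 + T v ^ 2 ^ l)`, which telescopes
after multiplication by `1 - T v`. -/
theorem sum_pow_bitSum_erase_univ (hF : Fintype.card F = 2 ^ m) (T : F →*₀ W)
    (hT : Function.Injective T) {v : F} (hv : v ≠ 0) :
    ∑ A ∈ Finset.univ.erase (Finset.univ : Finset (Fin m)), T v ^ bitSum A =
      if v = 1 then (2 : W) ^ m - 1 else 0 := by
  have h1 : ∑ A : Finset (Fin m), T v ^ bitSum A = if v = 1 then (2 : W) ^ m else 1 := by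
    split_ifs with h1
    · simp [h1]
    · have h2 : ∑ A : Finset (Fin m), T v ^ bitSum A =
          ∏ l ∈ Finset.range m, (1 + T v ^ 2 ^ l) := by
        rw [← Fin.prod_univ_eq_prod_range (fun l => 1 + T v ^ 2 ^ l), Finset.prod_one_add,
          Finset.powerset_univ]
        simp only [bitSum, Finset.prod_pow_eq_pow_sum]
      have h3 : ∀ k, (1 - T v) * ∏ l ∈ Finset.range k, (1 + T v ^ 2 ^ l) = 1 - T v ^ 2 ^ k := by
        intro k
        induction k with
        | zero => simp
        | succ k ih =>
          rw [Finset.prod_range_succ, ← mul_assoc, ih]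
          ring
      have h4 := h3 m
      rw [← hF, ← map_pow, FiniteField.pow_card, ← h2] at h4
      have h5 : 1 - T v ≠ 0 := by
        rw [sub_ne_zero]
        intro h6
        exact h1 (hT (by rw [map_one, h6]))
      exact mul_left_cancel₀ h5 (by rw [h4, mul_one])
  have h2 := Finset.sum_erase_eq_sub (f := fun A : Finset (Fin m) => T v ^ bitSum A)
    (Finset.mem_univ Finset.univ)
  rw [h2, h1, bitSum_univ, ← hF, map_pow_card_sub_one T hv]
  split_ifs <;> simp

/-- The expansion of the additive character in powers of the Teichmüller lift: the coefficient of
the exponent with digit set `A` is `2 ^ #A` times a principal unit. -/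
theorem IsTeichmullerLift.exists_traceChar_eq_sum (h : IsTeichmullerLift π T)
    (hF : Fintype.card F = 2 ^ m) (hm : 0 < m) :
    ∃ c : Finset (Fin m) → W, (∀ A, π (c A) = 1) ∧
      ∀ u, traceChar hF T u = ∑ A, 2 ^ A.card * c A * T u ^ bitSum A := by
  have hinj : Function.Injective T := Function.LeftInverse.injective h.map_lift
  have hπ2 : π 2 = 0 := by
    rw [map_ofNat]
    exact CharTwo.two_eq_zero
  have hr : π (2 ^ m - 1) = 1 := by
    rw [map_sub, map_pow, hπ2, zero_pow hm.ne', map_one, zero_sub, CharTwo.neg_eq]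
  obtain ⟨r, hru⟩ := h.isUnit _ (by rw [hr]; exact one_ne_zero)
  have hr1 : π (↑r⁻¹ : W) = 1 := by
    have h3 := congrArg π (Units.mul_inv r)
    rwa [map_mul, hru, hr, one_mul, map_one] at h3
  have hex : ∀ A : Finset (Fin m), ∃ g, π g = 1 ∧
      (A ≠ Finset.univ → bitGaussSum hF T Aᶜ = 2 ^ A.card * g) := by
    intro A
    by_cases hA : A = Finset.univ
    · exact ⟨1, map_one _, fun h1 => absurd hA h1⟩
    · obtain ⟨g, hg, hg1⟩ := h.exists_bitGaussSum_eq hF hm A hA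
      exact ⟨g, hg1, fun _ => hg⟩
  choose g hg1 hg using hex
  have hne : (Finset.univ : Finset (Fin m)) ≠ ∅ :=
    Finset.nonempty_iff_ne_empty.1 ⟨⟨0, hm⟩, Finset.mem_univ _⟩
  -- Fourier inversion on `Fˣ`: the Gauss sums are the Fourier coefficients of `ψ`.
  have hgauss : ∀ u : F, u ≠ 0 →
      ∑ A ∈ Finset.univ.erase (Finset.univ : Finset (Fin m)),
        2 ^ A.card * g A * T u ^ bitSum A = (2 ^ m - 1) * traceChar hF T u := by
    intro u hu
    have h1 : ∀ A ∈ Finset.univ.erase (Finset.univ : Finset (Fin m)),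
        2 ^ A.card * g A * T u ^ bitSum A =
          ∑ w, traceChar hF T w * if w = 0 then 0 else T (u * w⁻¹) ^ bitSum A := by
      intro A hA
      have hA' := Finset.ne_of_mem_erase hA
      rw [← hg A hA', bitGaussSum, Finset.sum_mul]
      refine Finset.sum_congr rfl fun w _ => ?_
      split_ifs with hw
      · have := bitSum_pos (A := Aᶜ) (Finset.nonempty_iff_ne_empty.2 (by simpa using hA'))
        rw [hw, map_zero, zero_pow this.ne']
        simp
      · have h2 : T w ^ bitSum Aᶜ = T w⁻¹ ^ bitSum A := by
          have h3 : T w ^ bitSum A ≠ 0 := by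
            rw [← map_pow]
            exact (map_ne_zero_iff T hinj).2 (pow_ne_zero _ hw)
          refine mul_left_cancel₀ h3 ?_
          rw [← pow_add, bitSum_add_compl, ← hF, map_pow_card_sub_one T hw, ← mul_pow,
            ← map_mul, mul_inv_cancel₀ hw, map_one, one_pow]
        rw [h2, map_mul, mul_pow]
        ring
    rw [Finset.sum_congr rfl h1, Finset.sum_comm]
    have h2 : ∀ w : F, ∑ A ∈ Finset.univ.erase (Finset.univ : Finset (Fin m)),
        traceChar hF T w * (if w = 0 then 0 else T (u * w⁻¹) ^ bitSum A) =
          if w = u then (2 ^ m - 1) * traceChar hF T u else 0 := by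
      intro w
      rw [← Finset.mul_sum]
      by_cases hw : w = 0
      · simp [hw, hu.symm]
      · simp only [if_neg hw]
        rw [sum_pow_bitSum_erase_univ hF T hinj (mul_ne_zero hu (inv_ne_zero hw))]
        simp only [mul_inv_eq_one₀ hw]
        by_cases hwu : w = u
        · rw [if_pos hwu.symm, if_pos hwu, hwu, mul_comm]
        · rw [if_neg (Ne.symm hwu), if_neg hwu, mul_zero]
    rw [Finset.sum_congr rfl fun w _ => h2 w]
    simp
  have hg0 : g ∅ = -1 := by
    have := hg ∅ hne.symm
    rw [Finset.compl_empty, h.bitGaussSum_univ hF hm] at this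
    simpa using this.symm
  -- Inversion gives the constant term `-1 / (q - 1)`, but `ψ 0 = 1` demands `1`. On `Fˣ` the
  -- exponents `0` and `q - 1` agree, so the difference `-q / (q - 1)` moves to the exponent `q -
  -- 1`; it is `2 ^ m` times the principal unit `-r⁻¹`.
  refine ⟨fun A => if A = ∅ then 1 else if A = Finset.univ then -(↑r⁻¹ : W) else g A * ↑r⁻¹,
    ?_, ?_⟩
  · intro A
    dsimp only
    split_ifs
    · exact map_one _
    · rw [map_neg, hr1, CharTwo.neg_eq]
    · rw [map_mul, hg1, hr1, one_mul]
  · intro u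
    by_cases hu : u = 0
    · rw [hu, AddChar.map_zero_eq_one, Finset.sum_eq_single ∅]
      · simp
      · intro A _ hA
        have := bitSum_pos (Finset.nonempty_iff_ne_empty.2 hA)
        rw [map_zero, zero_pow this.ne', mul_zero]
      · simp
    · have h1 := hgauss u hu
      have hmem : (∅ : Finset (Fin m)) ∈ Finset.univ.erase (Finset.univ : Finset (Fin m)) := by
        simp [hne.symm]
      rw [← Finset.add_sum_erase _ _ (Finset.mem_univ Finset.univ),
        ← Finset.add_sum_erase _ _ hmem]
      rw [← Finset.add_sum_erase _ _ hmem, hg0] at h1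
      have h2 : ∀ A ∈ (Finset.univ.erase (Finset.univ : Finset (Fin m))).erase ∅,
          2 ^ A.card * (if A = ∅ then (1 : W) else if A = Finset.univ then -(↑r⁻¹ : W)
            else g A * ↑r⁻¹) * T u ^ bitSum A = 2 ^ A.card * g A * T u ^ bitSum A * ↑r⁻¹ := by
        intro A hA
        rw [if_neg (Finset.ne_of_mem_erase hA),
          if_neg (Finset.ne_of_mem_erase (Finset.mem_of_mem_erase hA))]
        ring
      rw [Finset.sum_congr rfl h2, ← Finset.sum_mul]
      beta_reduce
      rw [if_neg hne, if_pos rfl, if_pos rfl,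
        bitSum_univ, ← hF, map_pow_card_sub_one T hu]
      simp only [Finset.card_univ, Fintype.card_fin, Finset.card_empty, pow_zero, bitSum_empty,
        mul_one, one_mul] at h1 ⊢
      have h3 : (↑r : W) * ↑r⁻¹ = 1 := Units.mul_inv r
      rw [hru] at h3
      linear_combination (-(↑r⁻¹ : W)) * h1 - (traceChar hF T u - 1) * h3

end Teichmuller

/-! ### The character sum of a polynomial modulo `2 q ^ 2`. -/

theorem AddChar.map_sum_eq_prod_apply {ι A M : Type*} [AddCommMonoid A] [CommMonoid M]
    (ψ : AddChar A M) (s : Finset ι) (f : ι → A) : ψ (∑ i ∈ s, f i) = ∏ i ∈ s, ψ (f i) := by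
  classical
  induction s using Finset.induction_on with
  | empty => simp
  | insert i s hi ih => rw [Finset.sum_insert hi, Finset.prod_insert hi, ψ.map_add_eq_mul, ih]

section CharacterSum

variable {ι : Type*} [Fintype ι] [DecidableEq ι] {n m : ℕ}

/-- The monomials with exponent vectors `E i`, `i ∈ P`, form a pair with product `X₁ ⋯ Xₙ`. -/
def IsComplementaryPair (E : ι → Fin n → ℕ) (P : Finset ι) : Prop :=
  P.card = 2 ∧ ∀ j, ∑ i ∈ P, E i j = 1

instance (E : ι → Fin n → ℕ) : DecidablePred (IsComplementaryPair E) := fun P =>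
  inferInstanceAs (Decidable (P.card = 2 ∧ ∀ j, ∑ i ∈ P, E i j = 1))

/-- The sum of the products of the coefficients of complementary pairs of monomials. -/
def pairForm {F : Type*} [Field F] (E : ι → Fin n → ℕ) (a : ι → F) : F :=
  ∑ P : Finset ι with IsComplementaryPair E P, ∏ i ∈ P, a i

/-- A set of pairs `(i, l)`, seen as a family indexed by `i` or by `l`. -/
def finsetFlip (ι κ : Type*) [Fintype ι] [DecidableEq ι] [Fintype κ] [DecidableEq κ] :
    (ι → Finset κ) ≃ (κ → Finset ι) where
  toFun k l := Finset.univ.filter fun i => l ∈ k i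
  invFun k i := Finset.univ.filter fun l => i ∈ k l
  left_inv k := by
    ext
    simp
  right_inv k := by
    ext
    simp

theorem mem_finsetFlip {κ : Type*} [Fintype κ] [DecidableEq κ] {k : ι → Finset κ} {l : κ} {i : ι} :
    i ∈ finsetFlip ι κ k l ↔ l ∈ k i := by
  simp [finsetFlip]

theorem sum_sum_finsetFlip {κ M : Type*} [Fintype κ] [DecidableEq κ] [AddCommMonoid M]
    (k : ι → Finset κ) (f : ι → κ → M) :
    ∑ l, ∑ i ∈ finsetFlip ι κ k l, f i l = ∑ i, ∑ l ∈ k i, f i l :=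
  Finset.sum_comm' fun l i => by simp [mem_finsetFlip]

theorem prod_prod_finsetFlip {κ M : Type*} [Fintype κ] [DecidableEq κ] [CommMonoid M]
    (k : ι → Finset κ) (f : ι → κ → M) :
    ∏ l, ∏ i ∈ finsetFlip ι κ k l, f i l = ∏ i, ∏ l ∈ k i, f i l :=
  Finset.prod_comm' fun l i => by simp [mem_finsetFlip]

/-- Regrouped by binary position, the total exponent of the variable `j` has generalized digits,
possibly above `1`, to which the digit-sum bound applies. -/
theorem sum_mul_bitSum_eq (E : ι → Fin n → ℕ) (k : ι → Finset (Fin m)) (j : Fin n) :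
    ∑ i, E i j * bitSum (k i) =
      ∑ l : Fin m, 2 ^ (l : ℕ) * ∑ i ∈ finsetFlip ι (Fin m) k l, E i j := by
  simp only [bitSum, Finset.mul_sum]
  rw [← sum_sum_finsetFlip]
  simp only [mul_comm]

theorem sum_card_mul_eq (E : ι → Fin n → ℕ) (k : ι → Finset (Fin m)) (j : Fin n) :
    ∑ l : Fin m, ∑ i ∈ finsetFlip ι (Fin m) k l, E i j = ∑ i, (k i).card * E i j := by
  rw [sum_sum_finsetFlip]
  simp

theorem sum_card_finsetFlip (k : ι → Finset (Fin m)) :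
    ∑ l : Fin m, (finsetFlip ι (Fin m) k l).card = ∑ i, (k i).card := by
  simp only [Finset.card_eq_sum_ones]
  exact sum_sum_finsetFlip k fun _ _ => 1

/-- Ax's estimate, with the case of equality, for monomials of degree at most half the number of
variables. -/
theorem two_mul_le_sum_card_add {d : ℕ} (hd : 2 ≤ d) (hn : n = 2 * d) (hm : 0 < m)
    (E : ι → Fin n → ℕ) (hE : ∀ i, ∑ j, E i j ≤ d) (k : ι → Finset (Fin m))
    (hk : ∀ j, 2 ^ m - 1 ∣ ∑ i, E i j * bitSum (k i)) :
    2 * m ≤ ∑ i, (k i).card +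
        m * (Finset.univ.filter fun j => ∑ i, E i j * bitSum (k i) = 0).card ∧
      (∑ i, (k i).card +
        m * (Finset.univ.filter fun j => ∑ i, E i j * bitSum (k i) = 0).card = 2 * m →
        ∀ l, IsComplementaryPair E (finsetFlip ι (Fin m) k l)) := by
  set X : Fin n → ℕ := fun j => ∑ i, E i j * bitSum (k i) with hX
  set z := (Finset.univ.filter fun j => X j = 0).card with hz
  set K := ∑ i, (k i).card with hK
  have hdig : ∀ j, X j ≠ 0 → m ≤ ∑ i, (k i).card * E i j ∧
      (∑ i, (k i).card * E i j = m →
        ∀ l, ∑ i ∈ finsetFlip ι (Fin m) k l, E i j = 1) := by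
    intro j hj
    have h1 := hk j
    have h2 : 0 < X j := Nat.pos_of_ne_zero hj
    simp only [hX] at h2
    rw [sum_mul_bitSum_eq] at h1 h2
    have h3 := le_sum_of_dvd_sum_two_pow_mul hm _ h1 h2
    rwa [sum_card_mul_eq] at h3
  have htot : ∑ j, ∑ i, (k i).card * E i j ≤ d * K := by
    rw [Finset.sum_comm, hK, Finset.mul_sum]
    refine Finset.sum_le_sum fun i _ => ?_
    rw [← Finset.mul_sum, mul_comm]
    exact Nat.mul_le_mul_right _ (hE i)
  have hlow : m * n ≤ ∑ j, ∑ i, (k i).card * E i j + m * z := by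
    have h1 : ∑ j : Fin n, m ≤
        ∑ j, (∑ i, (k i).card * E i j + m * if X j = 0 then 1 else 0) := by
      refine Finset.sum_le_sum fun j _ => ?_
      by_cases hj : X j = 0
      · simp [hj]
      · simpa [hj] using (hdig j hj).1
    rw [Finset.sum_add_distrib, ← Finset.mul_sum, ← Finset.card_filter] at h1
    simpa [mul_comm] using h1
  have hmn : m * n = d * (2 * m) := by
    rw [hn]
    ring
  obtain ⟨d', rfl⟩ : ∃ d', d = d' + 2 := ⟨d - 2, by omega⟩
  -- From `m n ≤ d K + m z` and `m n = 2 m d`. The surplus `(d - 1) m z` forces `z = 0` in the case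
  -- of equality because `d ≥ 2`; for `d = 1` the term with every `k i` empty would also attain the
  -- bound.
  have hmain : (d' + 2) * (2 * m) + (d' + 1) * (m * z) ≤ (d' + 2) * (K + m * z) := by
    nlinarith
  refine ⟨Nat.le_of_mul_le_mul_left (le_trans (Nat.le_add_right _ _) hmain) (by omega), ?_⟩
  intro heq
  have hz0 : m * z = 0 := by
    rw [heq] at hmain
    have h1 : (d' + 1) * (m * z) = 0 := by omega
    exact (mul_eq_zero.1 h1).resolve_left (by omega)
  have hz1 : z = 0 := (mul_eq_zero.1 hz0).resolve_left hm.ne'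
  have hXne : ∀ j, X j ≠ 0 := by
    intro j hj
    have h1 := Finset.card_eq_zero.1 (hz ▸ hz1)
    have h2 : j ∈ Finset.univ.filter fun j => X j = 0 := by simp [hj]
    rw [h1] at h2
    simp at h2
  have hK2 : K = 2 * m := by omega
  have hsum : ∑ j : Fin n, m = ∑ j, ∑ i, (k i).card * E i j := by
    refine le_antisymm (Finset.sum_le_sum fun j _ => (hdig j (hXne j)).1) ?_
    refine htot.trans ?_
    rw [hK2, ← hmn]
    simp [mul_comm]
  have hB := (Finset.sum_eq_sum_iff_of_le fun j _ => (hdig j (hXne j)).1).1 hsum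
  have hone : ∀ j l, ∑ i ∈ finsetFlip ι (Fin m) k l, E i j = 1 := fun j =>
    (hdig j (hXne j)).2 (hB j (Finset.mem_univ j)).symm
  -- The monomials of layer `l` have total degree `n = 2 d` and each has degree at most `d`, so
  -- there are at least two; the total `K = 2 m` leaves exactly two per layer.
  have hcard : ∀ l, 2 ≤ (finsetFlip ι (Fin m) k l).card := by
    intro l
    have h1 : n = ∑ j, ∑ i ∈ finsetFlip ι (Fin m) k l, E i j := by simp [hone]
    rw [Finset.sum_comm] at h1
    have h2 := Finset.sum_le_card_nsmul (finsetFlip ι (Fin m) k l) (fun i => ∑ j, E i j) (d' + 2)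
      fun i _ => hE i
    rw [← h1, smul_eq_mul, hn] at h2
    exact Nat.le_of_mul_le_mul_right h2 (by omega)
  have hcard2 : ∑ l : Fin m, 2 = ∑ l : Fin m, (finsetFlip ι (Fin m) k l).card := by
    rw [sum_card_finsetFlip, ← hK, hK2]
    simp [mul_comm]
  have h2 := (Finset.sum_eq_sum_iff_of_le fun l _ => hcard l).1 hcard2
  exact fun l => ⟨(h2 l (Finset.mem_univ l)).symm, fun j => hone j l⟩

variable {F W : Type*} [Field F] [Fintype F] [DecidableEq F] [CharP F 2] [CommRing W]
  [IsDomain W] {π : W →+* F} {T : F →*₀ W}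

/-- A term vanishes unless `q - 1` divides the exponent of each variable. Otherwise its power of `2`
has exponent `#k` summed over the monomials, plus `m` for each variable of exponent zero, and only
terms attaining the minimum `2 m` survive modulo `2`. -/
theorem IsTeichmullerLift.exists_term_eq (h : IsTeichmullerLift π T)
    (hF : Fintype.card F = 2 ^ m) (hm : 0 < m) {d : ℕ} (hd : 2 ≤ d) (hn : n = 2 * d)
    (E : ι → Fin n → ℕ) (hE : ∀ i, ∑ j, E i j ≤ d) (a : ι → F)
    (c : Finset (Fin m) → W) (hc : ∀ A, π (c A) = 1) (k : ι → Finset (Fin m)) :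
    ∃ D, (∏ i, 2 ^ (k i).card * c (k i) * T (a i) ^ bitSum (k i)) *
        ∏ j, ∑ x : F, T x ^ (∑ i, E i j * bitSum (k i)) = 2 ^ (2 * m) * D ∧
      π D = if ∀ l, IsComplementaryPair E (finsetFlip ι (Fin m) k l)
        then ∏ i, a i ^ bitSum (k i) else 0 := by
  have hπ2 : π 2 = 0 := by
    rw [map_ofNat]
    exact CharTwo.two_eq_zero
  have hX : (∀ l, IsComplementaryPair E (finsetFlip ι (Fin m) k l)) →
      ∀ j, ∑ i, E i j * bitSum (k i) = 2 ^ m - 1 := by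
    intro h1 j
    rw [sum_mul_bitSum_eq, ← bitSum_univ]
    exact Finset.sum_congr rfl fun l _ => by rw [(h1 l).2 j, mul_one]
  by_cases hdvd : ∀ j, 2 ^ m - 1 ∣ ∑ i, E i j * bitSum (k i)
  · set z := (Finset.univ.filter fun j => ∑ i, E i j * bitSum (k i) = 0).card with hz
    set K := ∑ i, (k i).card with hK
    have hprod : ∃ w, ∏ j, ∑ x : F, T x ^ (∑ i, E i j * bitSum (k i)) = 2 ^ (m * z) * w ∧
        π w = 1 := by
      refine ⟨∏ j : Fin n with ¬ ∑ i, E i j * bitSum (k i) = 0, ((2 : W) ^ m - 1), ?_, ?_⟩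
      · simp only [h.sum_pow, hF, if_pos (hdvd _)]
        rw [Finset.prod_ite]
        simp [pow_mul, hz]
      · rw [map_prod]
        refine Finset.prod_eq_one fun j _ => ?_
        rw [map_sub, map_pow, hπ2, zero_pow hm.ne', map_one, zero_sub, CharTwo.neg_eq]
    obtain ⟨w, hw, hw1⟩ := hprod
    obtain ⟨hle, heq⟩ := two_mul_le_sum_card_add hd hn hm E hE k hdvd
    rw [← hz, ← hK] at hle heq
    obtain ⟨r, hr⟩ := Nat.exists_eq_add_of_le hle
    refine ⟨2 ^ r * ((∏ i, c (k i)) * (∏ i, T (a i) ^ bitSum (k i)) * w), ?_, ?_⟩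
    · rw [hw, Finset.prod_mul_distrib, Finset.prod_mul_distrib, Finset.prod_pow_eq_pow_sum, ← hK]
      calc _ = 2 ^ (K + m * z) * ((∏ i, c (k i)) * (∏ i, T (a i) ^ bitSum (k i)) * w) := by
            rw [pow_add]
            ring
        _ = _ := by
            rw [hr, pow_add]
            ring
    · have h1 : π ((∏ i, c (k i)) * (∏ i, T (a i) ^ bitSum (k i)) * w) =
          ∏ i, a i ^ bitSum (k i) := by
        simp [map_prod, hc, h.map_lift, hw1]
      rw [map_mul, h1, map_pow, hπ2]
      by_cases hr0 : r = 0
      · rw [if_pos (heq (by omega)), hr0, pow_zero, one_mul]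
      · rw [zero_pow hr0, zero_mul, if_neg]
        intro h2
        have h3 : K = 2 * m := by
          rw [hK, ← sum_card_finsetFlip]
          simp [fun l => (h2 l).1, mul_comm]
        have h4 : z = 0 := by
          rw [hz, Finset.card_eq_zero, Finset.filter_eq_empty_iff]
          intro j _
          rw [hX h2 j]
          have : 2 ^ 1 ≤ 2 ^ m := Nat.pow_le_pow_right (by norm_num) hm
          omega
        rw [h3, h4] at hr
        omega
  · refine ⟨0, ?_, ?_⟩
    · obtain ⟨j, hj⟩ := not_forall.1 hdvd
      rw [Finset.prod_eq_zero (Finset.mem_univ j), mul_zero, mul_zero]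
      rw [h.sum_pow, hF, if_neg, if_neg hj]
      intro h0
      rw [h0] at hj
      exact hj (dvd_zero _)
    · rw [map_zero, if_neg]
      intro h1
      exact hdvd fun j => by rw [hX h1 j]

/-- Indexed by layers, the pairs are chosen independently, so the sum factors into `∏ₗ Q ^ 2 ^ l` by
Frobenius, and `∑ 2 ^ l = 2 ^ m - 1`. -/
theorem sum_complementary_eq_pairForm_pow (E : ι → Fin n → ℕ) (a : ι → F) :
    (∑ k : ι → Finset (Fin m), if ∀ l, IsComplementaryPair E (finsetFlip ι (Fin m) k l)
      then ∏ i, a i ^ bitSum (k i) else 0) = pairForm E a ^ (2 ^ m - 1) := by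
  have h1 : ∀ k : ι → Finset (Fin m),
      (if ∀ l, IsComplementaryPair E (finsetFlip ι (Fin m) k l)
        then ∏ i, a i ^ bitSum (k i) else 0) =
      ∏ l, if IsComplementaryPair E (finsetFlip ι (Fin m) k l)
        then (∏ i ∈ finsetFlip ι (Fin m) k l, a i) ^ 2 ^ (l : ℕ) else 0 := by
    intro k
    rw [Finset.prod_ite_zero]
    simp only [Finset.mem_univ, true_imp_iff]
    congr 1
    simp only [bitSum, ← Finset.prod_pow_eq_pow_sum, ← Finset.prod_pow]
    rw [prod_prod_finsetFlip]
  rw [Finset.sum_congr rfl fun k _ => h1 k]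
  rw [Equiv.sum_comp (finsetFlip ι (Fin m)) fun k : Fin m → Finset ι =>
    ∏ l, if IsComplementaryPair E (k l) then (∏ i ∈ k l, a i) ^ 2 ^ (l : ℕ) else 0]
  have h2 := Finset.prod_univ_sum (fun _ : Fin m => (Finset.univ : Finset (Finset ι)))
    (fun l P => if IsComplementaryPair E P then (∏ i ∈ P, a i) ^ 2 ^ (l : ℕ) else 0)
  rw [Fintype.piFinset_univ] at h2
  rw [← h2, ← bitSum_univ, bitSum, ← Finset.prod_pow_eq_pow_sum]
  refine Finset.prod_congr rfl fun l _ => ?_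
  rw [pairForm, sum_pow_char_pow, Finset.sum_filter]

/-- The character sum of a polynomial of degree at most half the number of variables. -/
theorem IsTeichmullerLift.exists_sum_traceChar_eq (h : IsTeichmullerLift π T)
    (hF : Fintype.card F = 2 ^ m) (hm : 0 < m) {d : ℕ} (hd : 2 ≤ d) (hn : n = 2 * d)
    (E : ι → Fin n → ℕ) (hE : ∀ i, ∑ j, E i j ≤ d) (a : ι → F) :
    ∃ C, ∑ x : Fin n → F, traceChar hF T (∑ i, a i * ∏ j, x j ^ E i j) = 2 ^ (2 * m) * C ∧
      π C = pairForm E a ^ (2 ^ m - 1) := by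
  obtain ⟨c, hc, hψ⟩ := h.exists_traceChar_eq_sum hF hm
  choose D hD hD1 using h.exists_term_eq hF hm hd hn E hE a c hc
  refine ⟨∑ k, D k, ?_, ?_⟩
  · rw [Finset.mul_sum]
    have h1 : ∀ x : Fin n → F, traceChar hF T (∑ i, a i * ∏ j, x j ^ E i j) =
        ∑ k : ι → Finset (Fin m), (∏ i, 2 ^ (k i).card * c (k i) * T (a i) ^ bitSum (k i)) *
          ∏ j, T (x j) ^ (∑ i, E i j * bitSum (k i)) := by
      intro x
      rw [AddChar.map_sum_eq_prod_apply]
      simp only [hψ]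
      rw [Finset.prod_univ_sum, Fintype.piFinset_univ]
      refine Finset.sum_congr rfl fun k _ => ?_
      simp only [← Finset.prod_pow_eq_pow_sum]
      rw [Finset.prod_comm, ← Finset.prod_mul_distrib]
      refine Finset.prod_congr rfl fun i _ => ?_
      rw [map_mul, map_prod, mul_pow, ← Finset.prod_pow]
      simp only [map_pow, pow_mul]
      ring
    simp only [h1]
    rw [Finset.sum_comm]
    refine Finset.sum_congr rfl fun k _ => ?_
    rw [← hD, ← Finset.mul_sum, Finset.prod_univ_sum, Fintype.piFinset_univ]
  · rw [map_sum, Finset.sum_congr rfl fun k _ => hD1 k, sum_complementary_eq_pairForm_pow]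

end CharacterSum

/-! ### From character sums to the number of zeros modulo `2 q`. -/

section Zeros

variable {ι : Type*} [Fintype ι] [DecidableEq ι] {n m : ℕ}
variable {F W : Type*} [Field F] [Fintype F] [DecidableEq F] [CharP F 2] [CommRing W]
  [IsDomain W] {π : W →+* F} {T : F →*₀ W}

theorem IsTeichmullerLift.two_pow_dvd_natCast_iff (h : IsTeichmullerLift π T) (r k : ℕ) :
    (2 : W) ^ r ∣ (k : W) ↔ 2 ^ r ∣ k := by
  constructor
  · induction r generalizing k with
    | zero => simp
    | succ r ih =>
      intro hk
      have hπ2 : π 2 = 0 := by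
        rw [map_ofNat]
        exact CharTwo.two_eq_zero
      have h1 : (k : F) = 0 := by
        obtain ⟨w, hw⟩ := (Dvd.intro_left _ (pow_succ (2 : W) r).symm).trans hk
        have := congrArg π hw
        rwa [map_natCast, map_mul, hπ2, zero_mul] at this
      obtain ⟨k', rfl⟩ := (CharP.cast_eq_zero_iff F 2 k).1 h1
      rw [pow_succ'] at hk ⊢
      refine mul_dvd_mul_left 2 (ih k' ?_)
      rw [Nat.cast_mul, Nat.cast_ofNat] at hk
      exact (mul_dvd_mul_iff_left h.two_ne_zero).1 hk
  · rintro ⟨k', rfl⟩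
    exact ⟨k', by push_cast; rfl⟩

theorem pairForm_smul (E : ι → Fin n → ℕ) (a : ι → F) (y : F) :
    pairForm E (fun i => y * a i) = y ^ 2 * pairForm E a := by
  rw [pairForm, pairForm, Finset.mul_sum]
  refine Finset.sum_congr rfl fun P hP => ?_
  rw [Finset.prod_mul_distrib, Finset.prod_const, (Finset.mem_filter.1 hP).2.1]

/-- The number of zeros of a polynomial of degree at most half the number of variables, to one
binary digit beyond the divisibility by `q` of Ax's theorem. -/
theorem IsTeichmullerLift.exists_card_zeros_eq (h : IsTeichmullerLift π T)
    (hF : Fintype.card F = 2 ^ m) (hm : 0 < m) {d : ℕ} (hd : 2 ≤ d) (hn : n = 2 * d)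
    (E : ι → Fin n → ℕ) (hE : ∀ i, ∑ j, E i j ≤ d) (a : ι → F) :
    ∃ C, ((Finset.univ.filter fun x : Fin n → F => ∑ i, a i * ∏ j, x j ^ E i j = 0).card : W) =
        2 ^ m * C ∧ π C = pairForm E a ^ (2 ^ m - 1) := by
  have hπ2 : π 2 = 0 := by
    rw [map_ofNat]
    exact CharTwo.two_eq_zero
  set f : (Fin n → F) → F := fun x => ∑ i, a i * ∏ j, x j ^ E i j with hf
  choose C hC hC1 using fun y : F =>
    h.exists_sum_traceChar_eq hF hm hd hn E hE (fun i => y * a i)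
  have hCf : ∀ y, ∑ x, traceChar hF T (y * f x) = 2 ^ (2 * m) * C y := by
    intro y
    rw [← hC]
    refine Finset.sum_congr rfl fun x _ => ?_
    rw [hf, Finset.mul_sum]
    simp only [mul_assoc]
  have hsum : (2 : W) ^ m * ((Finset.univ.filter fun x => f x = 0).card : W) =
      2 ^ (m * n) + ∑ y ∈ Finset.univ.erase (0 : F), 2 ^ (2 * m) * C y := by
    have h1 : ∑ x, ∑ y, traceChar hF T (y * f x) =
        (2 : W) ^ m * ((Finset.univ.filter fun x => f x = 0).card : W) := by
      simp only [h.sum_traceChar_mul hF hm]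
      rw [← Finset.sum_filter, Finset.sum_const, nsmul_eq_mul, mul_comm]
    rw [← h1, Finset.sum_comm, ← Finset.add_sum_erase _ _ (Finset.mem_univ (0 : F))]
    congr 1
    · simp [hF, pow_mul]
    · exact Finset.sum_congr rfl fun y _ => hCf y
  -- The first summand comes from `y = 0`; it is even since `n > 2`.
  refine ⟨2 ^ (m * (n - 2)) + ∑ y ∈ Finset.univ.erase (0 : F), C y, ?_, ?_⟩
  · refine mul_left_cancel₀ (pow_ne_zero m h.two_ne_zero) ?_
    rw [hsum, ← mul_assoc, ← pow_add, mul_add, ← pow_add, Finset.mul_sum, ← two_mul]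
    congr 2
    rw [mul_comm 2 m, ← mul_add]
    congr 1
    omega
  -- Scaling by `y` multiplies `Q` by `y ^ 2`, which the power `q - 1` makes invisible; the `q - 1`
  -- equal summands are odd in number.
  · have h1 : ∀ y ∈ Finset.univ.erase (0 : F), π (C y) = pairForm E a ^ (2 ^ m - 1) := by
      intro y hy
      have hy0 := Finset.ne_of_mem_erase hy
      rw [hC1, pairForm_smul, mul_pow, ← pow_mul, mul_comm 2, pow_mul, ← hF,
        FiniteField.pow_card_sub_one_eq_one y hy0, one_pow, one_mul]
    have h2 : m * (n - 2) ≠ 0 := mul_ne_zero hm.ne' (by omega)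
    have h3 : 0 < 2 ^ m := by positivity
    have h4 : (2 : F) = 0 := CharTwo.two_eq_zero
    rw [map_add, map_pow, hπ2, zero_pow h2, zero_add, map_sum, Finset.sum_congr rfl h1,
      Finset.sum_const, Finset.card_erase_of_mem (Finset.mem_univ _), Finset.card_univ, hF,
      nsmul_eq_mul, Nat.cast_sub h3, Nat.cast_pow, Nat.cast_ofNat, h4, zero_pow hm.ne',
      Nat.cast_one, zero_sub, CharTwo.neg_eq, one_mul]

theorem WittVector.isTeichmullerLift (F : Type*) [Field F] [Fintype F] [CharP F 2] :
    IsTeichmullerLift (WittVector.constantCoeff : WittVector 2 F →+* F)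
      { WittVector.teichmuller 2 with map_zero' := WittVector.teichmuller_zero 2 } where
  map_lift u := WittVector.teichmuller_coeff_zero 2 u
  two_dvd w hw := by
    have h1 : WittVector.verschiebung (w.shift 1) = w := by
      have := WittVector.verschiebung_shift w 0 fun i hi => by
        obtain rfl : i = 0 := by omega
        exact hw
      rw [this]
      ext i
      rw [WittVector.shift_coeff, zero_add]
    -- `F` is perfect, so Frobenius is onto, and Verschiebung after Frobenius is multiplication by
    -- `2`.
    obtain ⟨v, hv⟩ := (WittVector.frobenius_bijective 2 F).2 (w.shift 1)
    rw [← h1, ← hv, WittVector.verschiebung_frobenius]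
    exact Dvd.intro_left v (by push_cast; rfl)
  isUnit w hw := WittVector.isUnit_of_coeff_zero_ne_zero w hw
  two_ne_zero := by
    have := WittVector.p_nonzero 2 F
    exact_mod_cast this

/-- A polynomial of degree at most half the number of variables has a number of zeros divisible by
`2 q` if and only if the quadratic form in its coefficients vanishes. -/
theorem two_pow_dvd_card_zeros_iff (hF : Fintype.card F = 2 ^ m) (hm : 0 < m) {d : ℕ}
    (hd : 2 ≤ d) (hn : n = 2 * d) (E : ι → Fin n → ℕ) (hE : ∀ i, ∑ j, E i j ≤ d) (a : ι → F) :
    2 ^ (m + 1) ∣ (Finset.univ.filter fun x : Fin n → F =>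
      ∑ i, a i * ∏ j, x j ^ E i j = 0).card ↔ pairForm E a = 0 := by
  have h := WittVector.isTeichmullerLift F
  have hπ2 : (WittVector.constantCoeff : WittVector 2 F →+* F) 2 = 0 := by
    rw [map_ofNat]
    exact CharTwo.two_eq_zero
  obtain ⟨C, hC, hC1⟩ := h.exists_card_zeros_eq hF hm hd hn E hE a
  have hq : 2 ^ m - 1 ≠ 0 := by
    have : 2 ^ 1 ≤ 2 ^ m := Nat.pow_le_pow_right (by norm_num) hm
    omega
  rw [← h.two_pow_dvd_natCast_iff, hC, pow_succ,
    mul_dvd_mul_iff_left (pow_ne_zero m h.two_ne_zero), ← pow_eq_zero_iff hq, ← hC1]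
  constructor
  · rintro ⟨w, rfl⟩
    rw [map_mul, hπ2, zero_mul]
  · exact h.two_dvd C

end Zeros

/-! ### Counting exponent vectors. -/

section Dimension

open PowerSeries in
/-- The number of exponent vectors with entries less than `q` and sum at most `D`. -/
theorem card_bounded_exponents (n q D : ℕ) :
    ((Finset.univ.filter fun e : Fin n → Fin q => ∑ j, (e j : ℕ) ≤ D).card : ℤ) =
      ∑ j ∈ Finset.range (n + 1),
        if q * j ≤ D then (-1 : ℤ) ^ j * (n.choose j : ℤ) * ((n + (D - q * j)).choose n : ℤ)
        else 0 := by
  set S : PowerSeries ℤ := ∑ i : Fin q, X ^ (i : ℕ) with hS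
  set B : PowerSeries ℤ := mk fun k => ((n + k).choose n : ℤ) with hB
  -- Multiplication by `mk 1 = 1 / (1 - X)` takes partial sums of coefficients. With `S = (1 - X ^
  -- q) / (1 - X)` the series is `(1 - X ^ q) ^ n / (1 - X) ^ (n + 1)`.
  have h1 : coeff D (S ^ n * mk 1) =
      ((Finset.univ.filter fun e : Fin n → Fin q => ∑ j, (e j : ℕ) ≤ D).card : ℤ) := by
    have h2 : S ^ n = ∑ e : Fin n → Fin q, X ^ (∑ j, (e j : ℕ)) := by
      have h3 := Finset.prod_univ_sum (fun _ : Fin n => (Finset.univ : Finset (Fin q)))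
        (fun _ i => (X : PowerSeries ℤ) ^ (i : ℕ))
      rw [Fintype.piFinset_univ] at h3
      simpa [hS, Finset.prod_pow_eq_pow_sum] using h3
    rw [h2, Finset.sum_mul, map_sum]
    simp only [coeff_X_pow_mul', coeff_mk, Pi.one_apply]
    rw [Finset.sum_boole]
  have h4 : S * (1 - X) = 1 - X ^ q := by
    rw [hS, Fin.sum_univ_eq_sum_range (fun i => (X : PowerSeries ℤ) ^ i), geom_sum_mul_neg]
  have h5 : S ^ n * mk 1 = (1 - X ^ q) ^ n * B := by
    have h6 : B * (1 - X) ^ (n + 1) = 1 := mk_add_choose_mul_one_sub_pow_eq_one ℤ n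
    have h7 : (mk 1 : PowerSeries ℤ) * (1 - X) = 1 := mk_one_mul_one_sub_eq_one ℤ
    calc S ^ n * mk 1 = S ^ n * mk 1 * (B * (1 - X) ^ (n + 1)) := by rw [h6, mul_one]
      _ = (S * (1 - X)) ^ n * (mk 1 * (1 - X)) * B := by
        rw [mul_pow]
        ring
      _ = (1 - X ^ q) ^ n * B := by rw [h4, h7, mul_one]
  rw [← h1, h5, sub_eq_neg_add, add_pow, Finset.sum_mul, map_sum]
  refine Finset.sum_congr rfl fun j _ => ?_
  have h8 : (-(X : PowerSeries ℤ) ^ q) ^ j * 1 ^ (n - j) * (n.choose j : PowerSeries ℤ) * B =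
      X ^ (q * j) * (C ((-1) ^ j * (n.choose j : ℤ)) * B) := by
    rw [neg_pow, ← pow_mul]
    simp only [map_mul, map_pow, map_neg, map_one, map_natCast, one_pow]
    ring
  rw [h8, coeff_X_pow_mul']
  split_ifs
  · rw [coeff_C_mul, hB, coeff_mk]
  · rfl

end Dimension

/-! ### Zeros of hyperbolic forms and free coordinates. -/

section Counting

/-- The number of zeros of a hyperbolic quadratic form over a finite field. -/
theorem card_zeros_hyperbolic (F κ : Type*) [Field F] [Fintype F] [DecidableEq F] [Fintype κ]
    [DecidableEq κ] [Nonempty κ] :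
    Nat.card {b : κ ⊕ κ → F // ∑ i, b (Sum.inl i) * b (Sum.inr i) = 0} =
      Fintype.card F ^ (2 * Fintype.card κ - 1) +
        (Fintype.card F - 1) * Fintype.card F ^ (Fintype.card κ - 1) := by
  set q := Fintype.card F with hq
  set k := Fintype.card κ with hk
  have hk0 : 0 < k := Fintype.card_pos
  have hq0 : 0 < q := Fintype.card_pos
  -- Fibre over the left half `u`: the fibre is a hyperplane for `u ≠ 0` and the whole space for `u
  -- = 0`.
  have h1 : Nat.card {b : κ ⊕ κ → F // ∑ i, b (Sum.inl i) * b (Sum.inr i) = 0} =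
      Nat.card (Σ u : κ → F, {v : κ → F // ∑ i, u i * v i = 0}) := by
    refine Nat.card_congr ?_
    exact
      { toFun := fun b => ⟨fun i => b.1 (Sum.inl i), fun i => b.1 (Sum.inr i), b.2⟩
        invFun := fun p => ⟨Sum.elim p.1 p.2.1, p.2.2⟩
        left_inv := fun b => Subtype.ext (Sum.elim_comp_inl_inr b.1)
        right_inv := fun p => rfl }
  have h2 : ∀ u : κ → F, u ≠ 0 → Nat.card {v : κ → F // ∑ i, u i * v i = 0} = q ^ (k - 1) := by
    intro u hu
    let φ : Module.Dual F (κ → F) :=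
      { toFun := fun v => ∑ i, u i * v i
        map_add' := fun v w => by simp [mul_add, Finset.sum_add_distrib]
        map_smul' := fun c v => by
          simp only [Pi.smul_apply, smul_eq_mul, RingHom.id_apply, Finset.mul_sum]
          exact Finset.sum_congr rfl fun i _ => by ring }
    have hφ : φ ≠ 0 := by
      intro h0
      apply hu
      ext i
      have := LinearMap.congr_fun h0 (Pi.single i 1)
      simpa [φ, Pi.single_apply] using this
    have h3 := Module.Dual.finrank_ker_add_one_of_ne_zero hφ
    rw [Module.finrank_fintype_fun_eq_card] at h3
    have h4 : Nat.card (LinearMap.ker φ) = q ^ Module.finrank F (LinearMap.ker φ) := by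
      rw [Module.natCard_eq_pow_finrank (K := F), Nat.card_eq_fintype_card]
    have h5 : Module.finrank F (LinearMap.ker φ) = k - 1 := by omega
    rw [h5] at h4
    exact h4
  have h3 : Nat.card {v : κ → F // ∑ i, (0 : κ → F) i * v i = 0} = q ^ k := by
    simp [hq, hk]
  rw [h1, Nat.card_sigma, ← Finset.add_sum_erase _ _ (Finset.mem_univ (0 : κ → F)), h3,
    Finset.sum_congr rfl fun u hu => h2 u (Finset.ne_of_mem_erase hu), Finset.sum_const,
    Finset.card_erase_of_mem (Finset.mem_univ _), Finset.card_univ, Fintype.card_fun, smul_eq_mul]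
  obtain ⟨k', hk'⟩ : ∃ k', k = k' + 1 := ⟨k - 1, by omega⟩
  obtain ⟨q', hq'⟩ : ∃ q', q = q' + 1 := ⟨q - 1, by omega⟩
  have hpos : 0 < q ^ k := by positivity
  obtain ⟨Q, hQ⟩ : ∃ Q, q ^ k = Q + 1 := ⟨q ^ k - 1, by omega⟩
  rw [← hq, ← hk]
  have e1 : 2 * k - 1 = k + k' := by omega
  have e2 : k - 1 = k' := by omega
  have e3 : q ^ k = q * q ^ k' := by rw [hk', pow_succ']
  rw [e1, e2, pow_add, hQ, Nat.add_sub_cancel, ← hQ, e3]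
  have e4 : Q + 1 = q * q ^ k' := by rw [← hQ, e3]
  rw [hq', Nat.add_sub_cancel, ← hq', ← e4, add_mul, hq']
  rw [hq'] at e4
  rw [e4]
  ring

theorem card_comp_injective_mul {F ι κ : Type*} [Fintype F] [Fintype ι] [Fintype κ]
    (g : κ → ι) (hg : Function.Injective g) (P : (κ → F) → Prop) :
    Nat.card {a : ι → F // P (a ∘ g)} =
      Nat.card {b : κ → F // P b} * Fintype.card F ^ (Fintype.card ι - Fintype.card κ) := by
  classical
  let e := Equiv.ofInjective g hg
  let r := Equiv.piEquivPiSubtypeProd (· ∈ Set.range g) (fun _ : ι => F)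
  have h1 : {a : ι → F // P (a ∘ g)} ≃ {b : κ → F // P b} × ({i // i ∉ Set.range g} → F) :=
    calc {a : ι → F // P (a ∘ g)}
      _ ≃ {p : (Set.range g → F) × ({i // i ∉ Set.range g} → F) // P (p.1 ∘ e)} :=
        r.subtypeEquiv fun a => Iff.rfl
      _ ≃ {p : (κ → F) × ({i // i ∉ Set.range g} → F) // P p.1} :=
        ((e.symm.arrowCongr (Equiv.refl F)).prodCongr (Equiv.refl _)).subtypeEquiv fun p => Iff.rfl
      _ ≃ {b : κ → F // P b} × ({i // i ∉ Set.range g} → F) :=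
        Equiv.prodSubtypeFstEquivSubtypeProd
  rw [Nat.card_congr h1, Nat.card_prod, Nat.card_fun, Nat.card_eq_fintype_card (α := F)]
  congr 2
  rw [Nat.card_eq_fintype_card, Fintype.card_subtype_compl]
  congr 1
  exact Set.card_range_of_injective hg

end Counting

/-! ### Complementary pairs of squarefree monomials of degree `n / 2`. -/

section MiddleLayer

variable {n d : ℕ}

/-- Complementation exchanges the `d`-sets with and without `j₀`. Those containing `j₀` represent
each complementary pair once. -/
theorem two_mul_card_middle_sets (hn : n = 2 * d) (j₀ : Fin n) :
    2 * Fintype.card {I : Finset (Fin n) // I.card = d ∧ j₀ ∈ I} = n.choose d := by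
  have h1 : Fintype.card {I : Finset (Fin n) // I.card = d} = n.choose d := by
    rw [Fintype.card_finset_len, Fintype.card_fin]
  have h2 : Fintype.card {I : Finset (Fin n) // I.card = d ∧ j₀ ∈ I} =
      Fintype.card {I : Finset (Fin n) // I.card = d ∧ j₀ ∉ I} := by
    refine Fintype.card_congr ((Equiv.subtypeEquiv ⟨compl, compl, compl_compl, compl_compl⟩) ?_)
    intro I
    have h3 : I.card + Iᶜ.card = n := by rw [Finset.card_add_card_compl, Fintype.card_fin]
    simp only [Equiv.coe_fn_mk, Finset.mem_compl, not_not]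
    refine and_congr_left fun _ => ?_
    omega
  have h3 := Finset.card_filter_add_card_filter_not
    (s := Finset.univ.filter fun I : Finset (Fin n) => I.card = d) (fun I => j₀ ∈ I)
  rw [Finset.filter_filter, Finset.filter_filter, ← Fintype.card_subtype, ← Fintype.card_subtype,
    ← Fintype.card_subtype, ← h2, h1] at h3
  omega

/-- If all squarefree monomials of degree `d` occur, then `pairForm` is a hyperbolic quadratic form
in their coefficients. -/
theorem exists_pairForm_eq_hyperbolic {ι : Type*} [Fintype ι] [DecidableEq ι] (hn : n = 2 * d)
    (j₀ : Fin n) (E : ι → Fin n → ℕ) (hinj : Function.Injective E) (hE : ∀ i, ∑ j, E i j ≤ d)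
    (hsq : ∀ I : Finset (Fin n), I.card = d → ∃ i, ∀ j, E i j = if j ∈ I then 1 else 0) :
    ∃ g : {I : Finset (Fin n) // I.card = d ∧ j₀ ∈ I} ⊕
        {I : Finset (Fin n) // I.card = d ∧ j₀ ∈ I} → ι,
      Function.Injective g ∧ ∀ (F : Type*) [Field F] (a : ι → F),
        pairForm E a = ∑ I, a (g (Sum.inl I)) * a (g (Sum.inr I)) := by
  choose χ hχ using hsq
  have hcompl : ∀ I : Finset (Fin n), I.card = d → Iᶜ.card = d := by
    intro I hI
    rw [Finset.card_compl, Fintype.card_fin]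
    omega
  have hχinj : ∀ I hI J hJ, χ I hI = χ J hJ → I = J := by
    intro I hI J hJ h
    ext j
    have h1 := hχ I hI j
    rw [h, hχ J hJ j] at h1
    by_cases hi : j ∈ I <;> by_cases hj : j ∈ J <;> simp_all
  have hne : ∀ I hI J hJ, j₀ ∈ I → j₀ ∈ J → χ I hI ≠ χ Jᶜ hJ := by
    intro I hI J hJ h1 h2 h
    rw [hχinj _ _ _ _ h] at h1
    exact Finset.mem_compl.1 h1 h2
  refine ⟨Sum.elim (fun I => χ I.1 I.2.1) (fun I => χ I.1ᶜ (hcompl _ I.2.1)), ?_, ?_⟩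
  · rintro (⟨I, hI⟩ | ⟨I, hI⟩) (⟨J, hJ⟩ | ⟨J, hJ⟩) h
    · simp only [Sum.elim_inl] at h
      obtain rfl := hχinj _ _ _ _ h
      rfl
    · exact absurd h (hne _ _ _ _ hI.2 hJ.2)
    · exact absurd h.symm (hne _ _ _ _ hJ.2 hI.2)
    · simp only [Sum.elim_inr] at h
      obtain rfl := compl_injective (hχinj _ _ _ _ h)
      rfl
  · intro F _ a
    symm
    refine Finset.sum_bij (fun I _ => {χ I.1 I.2.1, χ I.1ᶜ (hcompl _ I.2.1)}) ?_ ?_ ?_ ?_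
    · rintro ⟨I, hI⟩ -
      have h1 := hne I hI.1 I (hcompl I hI.1) hI.2 hI.2
      refine Finset.mem_filter.2 ⟨Finset.mem_univ _, Finset.card_pair h1, fun j => ?_⟩
      rw [Finset.sum_pair h1, hχ, hχ]
      by_cases hj : j ∈ I <;> simp [hj]
    · rintro ⟨I, hI⟩ - ⟨J, hJ⟩ - h
      dsimp only at h
      have h1 : χ I hI.1 ∈ ({χ J hJ.1, χ Jᶜ (hcompl J hJ.1)} : Finset ι) := by
        rw [← h]
        exact Finset.mem_insert_self _ _
      rw [Finset.mem_insert, Finset.mem_singleton] at h1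
      exact Subtype.ext (hχinj _ _ _ _ (h1.resolve_right (hne _ _ _ _ hI.2 hJ.2)))
    · intro P hP
      obtain ⟨-, hcard, hsum⟩ := Finset.mem_filter.1 hP
      obtain ⟨u, v, huv, rfl⟩ := Finset.card_eq_two.1 hcard
      -- Exponents summing to `1` everywhere are indicators of complementary sets; both have at most
      -- `d` elements out of `2 d`, hence exactly `d`.
      have main : ∀ u v, (∀ j, E u j + E v j = 1) → E u j₀ = 1 →
          ∃ (I : Finset (Fin n)) (h : I.card = d), j₀ ∈ I ∧ χ I h = u ∧
            χ Iᶜ (hcompl I h) = v := by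
        intro u v huv hu
        set I := Finset.univ.filter fun j => E u j = 1 with hI
        have hEu : ∀ j, E u j = if j ∈ I then 1 else 0 := by
          intro j
          have := huv j
          simp only [hI, Finset.mem_filter, Finset.mem_univ, true_and]
          split_ifs <;> omega
        have hEv : ∀ j, E v j = if j ∈ Iᶜ then 1 else 0 := by
          intro j
          have h1 := huv j
          have h2 := hEu j
          simp only [Finset.mem_compl]
          split_ifs at h2 ⊢ <;> omega
        have h1 : I.card ≤ d := by
          have := hE u
          simpa [hEu] using this
        have h2 : Iᶜ.card ≤ d := by
          have := hE v
          simp only [hEv] at this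
          rw [← Finset.sum_filter, Finset.filter_mem_eq_inter, Finset.univ_inter] at this
          simpa using this
        have h3 : I.card + Iᶜ.card = n := by rw [Finset.card_add_card_compl, Fintype.card_fin]
        have h4 : I.card = d := by omega
        refine ⟨I, h4, by simp [hI, hu], hinj ?_, hinj ?_⟩
        · funext j
          rw [hχ, hEu]
        · funext j
          rw [hχ, hEv]
      have hsum' : ∀ j, E u j + E v j = 1 := fun j => by
        rw [← hsum j, Finset.sum_pair huv]
      rcases Nat.eq_zero_or_pos (E u j₀) with h0 | h0
      · obtain ⟨I, h, hj, h1, h2⟩ := main v u (fun j => by rw [add_comm, hsum'])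
          (by have := hsum' j₀; omega)
        exact ⟨⟨I, h, hj⟩, Finset.mem_univ _, by simp only [h1, h2, Finset.pair_comm]⟩
      · obtain ⟨I, h, hj, h1, h2⟩ := main u v hsum' (by have := hsum' j₀; omega)
        exact ⟨⟨I, h, hj⟩, Finset.mem_univ _, by simp only [h1, h2]⟩
    · rintro ⟨I, hI⟩ -
      rw [Finset.prod_pair (hne I hI.1 I (hcompl I hI.1) hI.2 hI.2)]
      rfl

end MiddleLayer

/-! ### Codewords as coefficient vectors. -/

section ReedMullerCode

/-- The exponent vectors of the monomials in the Reed–Muller code. -/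
abbrev ReedMullerExponent (q d n : ℕ) : Type := {e : Fin n → Fin q // ∑ j, (e j : ℕ) ≤ d}

/-- The exponent vector as a finitely supported function. -/
noncomputable def ReedMullerExponent.toFinsupp {q d n : ℕ} (e : ReedMullerExponent q d n) :
    Fin n →₀ ℕ :=
  Finsupp.equivFunOnFinite.symm fun j => (e.1 j : ℕ)

theorem ReedMullerExponent.toFinsupp_apply {q d n : ℕ} (e : ReedMullerExponent q d n)
    (j : Fin n) : e.toFinsupp j = e.1 j := rfl

theorem ReedMullerExponent.toFinsupp_injective {q d n : ℕ} :
    Function.Injective (ReedMullerExponent.toFinsupp : ReedMullerExponent q d n → _) := by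
  intro e e' h
  refine Subtype.ext (funext fun j => Fin.ext ?_)
  rw [← toFinsupp_apply, h, toFinsupp_apply]

variable {F : Type*} [Field F] [Fintype F] {d n : ℕ}

theorem mem_ReedMuller_iff_support {f : MvPolynomial (Fin n) F} :
    f ∈ ReedMuller F d n ↔ ∀ s ∈ f.support,
      ∃ e : ReedMullerExponent (Fintype.card F) d n, e.toFinsupp = s := by
  have hq : 0 < Fintype.card F := Fintype.card_pos
  have hdeg : ∀ s : Fin n →₀ ℕ, (s.sum fun _ k => k) = ∑ j, s j := fun s =>
    Finsupp.sum_fintype _ _ fun _ => rfl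
  rw [ReedMuller, Submodule.mem_inf, MvPolynomial.mem_restrictTotalDegree,
    MvPolynomial.mem_restrictDegree, MvPolynomial.totalDegree, Finset.sup_le_iff]
  constructor
  · rintro ⟨h1, h2⟩ s hs
    have h3 := h1 s hs
    rw [hdeg] at h3
    exact ⟨⟨fun j => ⟨s j, by have := h2 s hs j; omega⟩, h3⟩, Finsupp.ext fun j => rfl⟩
  · intro h
    constructor
    · intro s hs
      obtain ⟨e, rfl⟩ := h s hs
      rw [hdeg]
      exact e.2
    · intro s hs j
      obtain ⟨e, rfl⟩ := h s hs
      have := (e.1 j).2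
      rw [ReedMullerExponent.toFinsupp_apply]
      omega

theorem coeff_sum_monomial_toFinsupp {q : ℕ} (a : ReedMullerExponent q d n → F)
    (e : ReedMullerExponent q d n) :
    MvPolynomial.coeff e.toFinsupp
      (∑ e' : ReedMullerExponent q d n, MvPolynomial.monomial e'.toFinsupp (a e')) = a e := by
  classical
  rw [MvPolynomial.coeff_sum, Finset.sum_eq_single e]
  · rw [MvPolynomial.coeff_monomial, if_pos rfl]
  · intro e' _ he
    rw [MvPolynomial.coeff_monomial, if_neg]
    exact fun h => he (ReedMullerExponent.toFinsupp_injective h)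
  · exact fun h => absurd (Finset.mem_univ e) h

theorem sum_monomial_toFinsupp_mem (a : ReedMullerExponent (Fintype.card F) d n → F) :
    ∑ e, MvPolynomial.monomial e.toFinsupp (a e) ∈ ReedMuller F d n := by
  refine Submodule.sum_mem _ fun e _ => mem_ReedMuller_iff_support.2 fun s hs => ⟨e, ?_⟩
  exact (Finset.mem_singleton.1 (MvPolynomial.support_monomial_subset hs)).symm

theorem sum_monomial_coeff_toFinsupp (f : ReedMuller F d n) :
    ∑ e : ReedMullerExponent (Fintype.card F) d n,
      MvPolynomial.monomial e.toFinsupp (MvPolynomial.coeff e.toFinsupp f.1) = f.1 := by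
  have hmem := sum_monomial_toFinsupp_mem fun e : ReedMullerExponent (Fintype.card F) d n =>
    MvPolynomial.coeff e.toFinsupp f.1
  have key := coeff_sum_monomial_toFinsupp fun e : ReedMullerExponent (Fintype.card F) d n =>
    MvPolynomial.coeff e.toFinsupp f.1
  generalize ∑ e : ReedMullerExponent (Fintype.card F) d n,
    MvPolynomial.monomial e.toFinsupp (MvPolynomial.coeff e.toFinsupp f.1) = g at hmem key
  refine MvPolynomial.ext _ _ fun s => ?_
  by_cases hs : ∃ e : ReedMullerExponent (Fintype.card F) d n, e.toFinsupp = s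
  · obtain ⟨e, rfl⟩ := hs
    exact key e
  · rw [MvPolynomial.notMem_support_iff.1 fun h => hs (mem_ReedMuller_iff_support.1 hmem s h),
      MvPolynomial.notMem_support_iff.1 fun h => hs (mem_ReedMuller_iff_support.1 f.2 s h)]

/-- The coefficients of a codeword. -/
noncomputable def reedMullerCoeff (F : Type*) [Field F] [Fintype F] (d n : ℕ) :
    ReedMuller F d n ≃ₗ[F] (ReedMullerExponent (Fintype.card F) d n → F) where
  toFun f e := MvPolynomial.coeff e.toFinsupp f.1
  map_add' _ _ := rfl
  map_smul' c f := by
    funext e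
    exact MvPolynomial.coeff_smul _ _ _
  invFun a := ⟨_, sum_monomial_toFinsupp_mem a⟩
  left_inv f := Subtype.ext (sum_monomial_coeff_toFinsupp f)
  right_inv a := funext (coeff_sum_monomial_toFinsupp a)

theorem eval_eq_sum_reedMullerCoeff (f : ReedMuller F d n) (x : Fin n → F) :
    MvPolynomial.eval x f.1 = ∑ e, reedMullerCoeff F d n f e * ∏ j, x j ^ (e.1 j : ℕ) := by
  classical
  rw [MvPolynomial.eval_eq']
  have h1 : f.1.support ⊆ Finset.univ.image (ReedMullerExponent.toFinsupp :
      ReedMullerExponent (Fintype.card F) d n → _) := by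
    intro s hs
    obtain ⟨e, he⟩ := mem_ReedMuller_iff_support.1 f.2 s hs
    exact Finset.mem_image.2 ⟨e, Finset.mem_univ e, he⟩
  rw [Finset.sum_subset h1 fun s _ hs => by
    rw [MvPolynomial.notMem_support_iff.1 hs, zero_mul],
    Finset.sum_image ReedMullerExponent.toFinsupp_injective.injOn]
  rfl

theorem finrank_ReedMuller :
    Module.finrank F (ReedMuller F d n) =
      Fintype.card (ReedMullerExponent (Fintype.card F) d n) := by
  rw [(reedMullerCoeff F d n).finrank_eq, Module.finrank_fintype_fun_eq_card]

theorem finrank_ReedMuller_eq_sum (F : Type*) [Field F] [Fintype F] {d n : ℕ} (hd : d ≤ n) :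
    (Module.finrank F (ReedMuller F d n) : ℤ) =
      ∑ j ∈ Finset.range (d / Fintype.card F + 1),
        (-1 : ℤ) ^ j * (n.choose j : ℤ) * ((n + d - Fintype.card F * j).choose n : ℤ) := by
  set q := Fintype.card F with hq
  have hq0 : 0 < q := Fintype.card_pos
  rw [finrank_ReedMuller, Fintype.card_subtype, card_bounded_exponents, ← Finset.sum_filter]
  -- `d ≤ n` makes the bound `j ≤ n` automatic, and `q * j ≤ d` keeps the natural subtractions
  -- exact.
  have h1 : (Finset.range (n + 1)).filter (fun j => q * j ≤ d) = Finset.range (d / q + 1) := by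
    ext j
    rw [Finset.mem_filter, Finset.mem_range, Finset.mem_range, Nat.lt_succ_iff, Nat.lt_succ_iff,
      Nat.le_div_iff_mul_le hq0, mul_comm q]
    refine ⟨fun h => h.2, fun h => ⟨?_, h⟩⟩
    exact (Nat.le_mul_of_pos_right j hq0).trans (h.trans hd)
  rw [h1]
  refine Finset.sum_congr rfl fun j hj => ?_
  rw [← h1, Finset.mem_filter] at hj
  rw [Nat.add_sub_assoc hj.2]

variable [DecidableEq F]

theorem dvd_codewordWeight_iff {m : ℕ} (hF : Fintype.card F = 2 ^ m) (hm : 0 < m) (hd : 2 ≤ d)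
    (hn : n = 2 * d) (f : ReedMuller F d n) :
    2 ^ (m + 1) ∣ codewordWeight f.1 ↔
      pairForm (fun (e : ReedMullerExponent (Fintype.card F) d n) j => (e.1 j : ℕ))
        (reedMullerCoeff F d n f) = 0 := by
  have : CharP F 2 := charP_of_card_eq_prime_pow hF
  have h1 := codewordWeight_add_card_zeros f.1
  have h2 : 2 ^ (m + 1) ∣ Fintype.card F ^ n := by
    rw [hF, ← pow_mul]
    refine pow_dvd_pow 2 ?_
    have : m * 2 ≤ m * n := Nat.mul_le_mul_left m (by omega)
    omega
  rw [← two_pow_dvd_card_zeros_iff hF hm hd hn _ (fun e => e.2)]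
  simp only [eval_eq_sum_reedMullerCoeff] at h1
  rw [← h1] at h2
  exact ⟨fun h => (Nat.dvd_add_right h).1 h2, fun h => (Nat.dvd_add_left h).1 h2⟩

end ReedMullerCode

/-! ### The count and the dimension. -/

theorem corollary3p3 (F : Type*) [Field F] [Fintype F] [DecidableEq F] (m q n N : ℕ)
    (hq : q = 2 ^ m) (hF : Fintype.card F = q) (hn : 4 ≤ n) (heven : Even n)
    (hN : N = n.choose (n / 2)) :
    numCodewordsWeightDvd F (n / 2) n (2 ^ (m + 1)) =
        (q ^ (N - 1) + (q - 1) * q ^ (N / 2 - 1)) *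
          q ^ (Module.finrank F (ReedMuller F (n / 2) n) - N) ∧
      (Module.finrank F (ReedMuller F (n / 2) n) : ℤ) =
        ∑ j ∈ Finset.range (n / (2 * q) + 1),
          (-1 : ℤ) ^ j * (n.choose j : ℤ) * ((3 * n / 2 - q * j).choose n : ℤ) := by
  have hn2 : n = 2 * (n / 2) := (Nat.two_mul_div_two_of_even heven).symm
  have hm : 0 < m := by
    rcases Nat.eq_zero_or_pos m with rfl | h
    · have := Fintype.one_lt_card (α := F)
      omega
    · exact h
  have hFm : Fintype.card F = 2 ^ m := hF.trans hq
  constructor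
  · set d := n / 2 with hd
    have hd2 : 2 ≤ d := by omega
    have hq1 : 1 < Fintype.card F := Fintype.one_lt_card
    let E : ReedMullerExponent (Fintype.card F) d n → Fin n → ℕ := fun e j => e.1 j
    let j₀ : Fin n := ⟨0, by omega⟩
    have hinj : Function.Injective E := fun e e' h =>
      Subtype.ext (funext fun j => Fin.ext (congrFun h j))
    -- Squarefree monomials belong to the code because `q ≥ 2` allows the exponent `1`.
    have hsq : ∀ I : Finset (Fin n), I.card = d →
        ∃ i, ∀ j, E i j = if j ∈ I then 1 else 0 := by
      intro I hI
      refine ⟨⟨fun j => ⟨if j ∈ I then 1 else 0, by split_ifs <;> omega⟩, ?_⟩, fun j => rfl⟩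
      simp [hI]
    obtain ⟨g, hg, hform⟩ := exists_pairForm_eq_hyperbolic hn2 j₀ E hinj (fun e => e.2) hsq
    have hcardI := two_mul_card_middle_sets hn2 j₀
    rw [← hN] at hcardI
    have hcard : numCodewordsWeightDvd F d n (2 ^ (m + 1)) =
        Nat.card {a : ReedMullerExponent (Fintype.card F) d n → F // pairForm E a = 0} := by
      rw [numCodewordsWeightDvd, ← Nat.card_coe_set_eq]
      refine Nat.card_congr ?_
      refine Equiv.trans (Equiv.subtypeSubtypeEquivSubtypeInter (· ∈ ReedMuller F d n)
        (fun f => 2 ^ (m + 1) ∣ codewordWeight f)).symm ?_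
      exact (reedMullerCoeff F d n).toEquiv.subtypeEquiv fun f =>
        dvd_codewordWeight_iff hFm hm hd2 hn2 f
    have : Nonempty {I : Finset (Fin n) // I.card = d ∧ j₀ ∈ I} := by
      rw [← Fintype.card_pos_iff]
      have : 0 < N := hN ▸ Nat.choose_pos (by omega)
      omega
    -- Only the `N` middle squarefree coefficients enter the form; the others are free.
    have hcomp := card_comp_injective_mul (F := F) g hg
      (fun b => ∑ I, b (Sum.inl I) * b (Sum.inr I) = 0)
    have hhyp := card_zeros_hyperbolic F {I : Finset (Fin n) // I.card = d ∧ j₀ ∈ I}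
    rw [hhyp, Fintype.card_sum, ← two_mul, hcardI, ← finrank_ReedMuller,
      show Fintype.card {I : Finset (Fin n) // I.card = d ∧ j₀ ∈ I} = N / 2 by omega] at hcomp
    rw [hcard, ← hF, ← hcomp]
    refine Nat.card_congr (Equiv.subtypeEquivRight fun a => ?_)
    rw [hform F a]
    rfl
  · rw [finrank_ReedMuller_eq_sum F (by omega), hF, ← Nat.div_div_eq_div_mul]
    refine Finset.sum_congr rfl fun j _ => ?_
    rw [show n + n / 2 = 3 * n / 2 by omega]
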